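/- Let $\mathbb F$ be a finite field, $D\subseteq\mathbb F$ with $|D|=d\ge 1$. Consider the matrix multiplication function $D^{2n^2}\to\mathbb F^{n^2}$, $(A,B)\mapsto AB$, for $n\times n$ matrices $A,B$ with entries in $D$. \emph{Branching programs.} A $D$-way branching program $P$ of time $T$ has layers $L_0,\dots,L_T$ of nodes, $L_0$ consisting of the root only. Each non-sink node of layer $t<T$ queries one entry of $A$ or $B$ and has one outgoing edge into layer $t+1$ for each value in $D$; each edge may carry output statements $((i,j),o)$ with $o\in\mathbb F$. On an input, $P$ succeeds if along the followed path every entry of $AB$ is output with its correct value and no wrong value is output. Its cumulative memory is $CM(P)=\sum_{t=0}^{T}\log_2|L_t|$. A randomized branching program is a probability distribution on branching programs; it has time at most $T$ and cumulative memory at most $S$ if all programs in its support do. \emph{Random-access machines.} A RAM is a finite list of instructions acting on registers that hold natural numbers (constants, arbitrary binary operations, indirect load and store, jump on zero, random-access reading of the read-only input, writing of a statement (index, value) to the write-only output); field elements are represented by natural numbers through an arbitrary injection, the two matrices are stored in row-major order, and the index of an output entry is its row-major position. Every instruction takes unit time. The space of a configuration is the sum, over the registers with nonzero content, of the bit length of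 the address plus the bit length of the content. The cumulative memory on an input is the sum of the space over all times from the start until halting. The machine has time at most $T$ and cumulative memory at most $S$ if this is so on every input from $D^{2n^2}$. It succeeds on an input if it outputs exactly the entries of $AB$. A randomized RAM is a probability distribution on such programs, and a bound on time, cumulative memory or program length is required for all programs in its support. \textbf{Theorem.} Let $c\in\mathbb R$. (a) There are $\varepsilon>0$ and $n_0$, depending only on $c$, such that for all $n\ge n_0$ and all $\mathbb F$, $D$, $d$ as above: if a (randomized) $D$-way branching program with time at most $T$ and cumulative memory at most $S$ correctly multiplies two independent uniformly random matrices in $D^{n\times n}$ with probability at least $n^{-c}$ (over the inputs and the program), then $$T\ \ge\ \varepsilon\,\frac{n^3\sqrt{\log_2 d}}{\log_2 n}\qquad\text{or}\qquad T\cdot S\ \ge\ \varepsilon\, n^6\log_2 d ,$$ that is, the time is $\Omega(n^3\sqrt{\log d}/\log n)$ or the cumulative memory is $\Omega(n^6\log d/T)$. (b) There is $\varepsilon>0$, depending only on $c$, such that for every $\ell$ there is $n_0$, depending only on $c$ and $\ell$, such that for all $n\ge n_0$ and all $\mathbb F$, $D$, $d$ as above: if a (randomized) random-access machine with at most $\ell$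 instructions, time at most $T$ and cumulative memory at most $S$ correctly multiplies two independent uniformly random matrices in $D^{n\times n}$ with probability at least $n^{-c}$, then $T\cdot S\ge\varepsilon\, n^6\log_2 d$, without any condition on $T$. -/

import Mathlib

open scoped BigOperators

universe u

/-- A layered `D`-way branching program reading an input `x : ι → D` and producing ordered outputs,
i.e. statements `(j, o)` with output index `j : κ` and value `o : R`. Layer `t` is `Fin (width t)`.
Only layers `0, …, time` and the edges leaving layers `0, …, time - 1` matter. -/
structure BranchingProgram (ι κ D R : Type*) where
  /-- the number of steps `T`; the program has the `T + 1` layers `0, …, T` -/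
  time : ℕ
  /-- the number of nodes in layer `t` -/
  width : ℕ → ℕ
  /-- the root is the only node of layer `0` -/
  width_zero : width 0 = 1
  /-- the input coordinate queried at a node; `none` means that the node is a sink -/
  query : ∀ t, Fin (width t) → Option ι
  /-- the end of the edge leaving a node for a given value of the queried coordinate -/
  next : ∀ t, Fin (width t) → D → Fin (width (t + 1))
  /-- the output statements on that edge -/
  out : ∀ t, Fin (width t) → D → List (κ × R)

namespace BranchingProgram

variable {ι κ D R : Type*}

/-- The node in layer `t` reached on input `x`; `none` if a sink was reached in an earlier layer. -/
def node (P : BranchingProgram ι κ D R) (x : ι → D) : (t : ℕ) → Option (Fin (P.width t))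
  | 0 => some ⟨0, by simp [P.width_zero]⟩
  | t + 1 => (P.node x t).bind fun v => (P.query t v).map fun i => P.next t v (x i)

/-- On input `x` the program produces the output statement `(j, o)`. -/
def Emits (P : BranchingProgram ι κ D R) (x : ι → D) (j : κ) (o : R) : Prop :=
  ∃ t < P.time, ∃ v i, P.node x t = some v ∧ P.query t v = some i ∧ (j, o) ∈ P.out t v (x i)

/-- On input `x` the program produces the vector `y`: every entry of `y` is output (in any time
order) and no wrong value is ever output. -/
def Produces (P : BranchingProgram ι κ D R) (x : ι → D) (y : κ → R) : Prop :=
  ∀ j o, P.Emits x j o ↔ o = y j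

/-- Cumulative memory: the sum over all layers of the logarithm of the number of nodes. -/
noncomputable def cumulativeMemory (P : BranchingProgram ι κ D R) : ℝ :=
  ∑ t ∈ Finset.range (P.time + 1), Real.logb 2 (P.width t)

end BranchingProgram

namespace RAM

/-- Instructions of a random-access machine with registers `0, 1, 2, …` holding natural numbers,
a read-only random-access input and a write-only output. Any binary operation on natural numbers
(addition, multiplication, bit operations, field operations in an encoding, …) may be used as a
single instruction. -/
inductive Instr where
  /-- `reg dst := k` -/
  | const (dst k : ℕ)
  /-- `reg dst := f (reg a) (reg b)` -/
  | op (f : ℕ → ℕ → ℕ) (dst a b : ℕ)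
  /-- `reg dst := reg (reg a)` -/
  | load (dst a : ℕ)
  /-- `reg (reg a) := reg b` -/
  | store (a b : ℕ)
  /-- `reg dst := input (reg a)` -/
  | read (dst a : ℕ)
  /-- output the statement `(reg a, reg b)` -/
  | write (a b : ℕ)
  /-- continue at instruction `l` if `reg a = 0` -/
  | jumpIfZero (a l : ℕ)

/-- A program; the machine halts when the program counter leaves the list. -/
abbrev Program := List Instr

/-- A configuration: program counter and register contents (almost all of them zero). -/
structure Config where
  pc : ℕ
  reg : ℕ →₀ ℕ

/-- Logarithmic-cost space: every register in use (that is, with nonzero content) is charged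
the bit length of its address plus the bit length of its content. -/
def Config.space (s : Config) : ℕ :=
  ∑ r ∈ s.reg.support, (Nat.size r + Nat.size (s.reg r))

/-- The machine has halted. -/
def Halted (M : Program) (s : Config) : Prop := M.length ≤ s.pc

/-- One (unit-cost) step on the input `w`. -/
noncomputable def step (M : Program) (w : ℕ → ℕ) (s : Config) : Config :=
  match M[s.pc]? with
  | none => s
  | some (.const dst k) => ⟨s.pc + 1, s.reg.update dst k⟩
  | some (.op f dst a b) => ⟨s.pc + 1, s.reg.update dst (f (s.reg a) (s.reg b))⟩
  | some (.load dst a) => ⟨s.pc + 1, s.reg.update dst (s.reg (s.reg a))⟩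
  | some (.store a b) => ⟨s.pc + 1, s.reg.update (s.reg a) (s.reg b)⟩
  | some (.read dst a) => ⟨s.pc + 1, s.reg.update dst (w (s.reg a))⟩
  | some (.write _ _) => ⟨s.pc + 1, s.reg⟩
  | some (.jumpIfZero a l) => ⟨if s.reg a = 0 then l else s.pc + 1, s.reg⟩

/-- The configuration after `t` steps, started at instruction `0` with all registers zero. -/
noncomputable def config (M : Program) (w : ℕ → ℕ) (t : ℕ) : Config :=
  (step M w)^[t] ⟨0, 0⟩

/-- On input `w` the machine outputs the statement `(k, v)` at some step. -/
def Emits (M : Program) (w : ℕ → ℕ) (k v : ℕ) : Prop :=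
  ∃ t a b, M[(config M w t).pc]? = some (.write a b) ∧
    (config M w t).reg a = k ∧ (config M w t).reg b = v

/-- On input `w` the machine halts after some number `τ ≤ T` of steps, and its cumulative memory
on this input, the sum of the space used at times `0, …, τ`, is at most `S`. -/
def RunsWithin (M : Program) (w : ℕ → ℕ) (T S : ℕ) : Prop :=
  ∃ τ ≤ T, Halted M (config M w τ) ∧ (∀ t < τ, ¬ Halted M (config M w t)) ∧
    ∑ t ∈ Finset.range (τ + 1), (config M w t).space ≤ S

end RAM

namespace MatMul

/-- Indices of the `2 n²` input entries: `inl (i, j)` is the entry `(i, j)` of the first matrix,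
`inr (i, j)` that of the second. -/
abbrev Idx (n : ℕ) := (Fin n × Fin n) ⊕ (Fin n × Fin n)

variable {F : Type*} {n : ℕ} {D : Finset F}

/-- The first input matrix. -/
def left (x : Idx n → D) : Matrix (Fin n) (Fin n) F := fun i j => (x (.inl (i, j)) : F)

/-- The second input matrix. -/
def right (x : Idx n → D) : Matrix (Fin n) (Fin n) F := fun i j => (x (.inr (i, j)) : F)

/-- The matrix multiplication function `D^{2n²} → F^{n²}`. -/
def product [Field F] (x : Idx n → D) (p : Fin n × Fin n) : F := (left x * right x) p.1 p.2

/-- The input as seen by a random-access machine: cells `0, …, n² - 1` hold the first matrix in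
row-major order, cells `n², …, 2n² - 1` the second one, field elements being represented by natural
numbers through `enc`. -/
def tape (enc : F ↪ ℕ) (x : Idx n → D) (k : ℕ) : ℕ :=
  if h : k < n * n then enc (x (.inl (finProdFinEquiv.symm ⟨k, h⟩)))
  else if h : k - n * n < n * n then enc (x (.inr (finProdFinEquiv.symm ⟨k - n * n, h⟩)))
  else 0

/-- The machine outputs the product on input `x`: every entry `(i, j)` is output under its row-major
index, and nothing else is output. -/
def RAMProduces [Field F] (M : RAM.Program) (enc : F ↪ ℕ) (x : Idx n → D) : Prop :=
  ∀ k v, RAM.Emits M (tape enc x) k v ↔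
    ∃ i j : Fin n, k = i * n + j ∧ v = enc (product x (i, j))

/-- The probability of the event `E` for a uniformly random pair of matrices with entries in `D`. -/
noncomputable def prob (E : (Idx n → D) → Prop) : ℝ :=
  (Nat.card {x // E x} : ℝ) / Nat.card (Idx n → D)

end MatMul

/-!
Deleting a few rows from a random matrix leaves every small set of columns with rank at least half
its size, by a union bound over the linear relations between the columns. If `B` and `Aᵀ` are rigid
in this sense, then a computation that makes few queries and outputs `k` entries outputs most of
them in rows of `A` or columns of `B` of which it has queried little, where correctness imposes
`Ω(k)` independent linear conditions on unqueried entries. The inputs that follow the same path form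
a cylinder, so few queries made from a given state yield `k` correct outputs with probability only
`d ^ (-Ω(k))`.

A union bound over the at most `2 ^ y` states of space `y`, for each `y`, then shows that on most
correctly treated inputs no block of `∝ 2 ^ i` steps that starts in a state of space `∝ 4 ^ i`
outputs `∝ 4 ^ i` entries. Cut the computation from its end backwards, each time into a last block
of the smallest possible kind: the times at which shorter blocks would have started then have states
of large space. A block of kind `i` has length `∝ 2 ^ i`, output `∝ 4 ^ i` and cumulative memory
`∝ 8 ^ i`, and the Cauchy-Schwarz inequality `(∑ 4 ^ i) ^ 2 ≤ (∑ 2 ^ i) * (∑ 8 ^ i)` bounds the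
product of time and cumulative memory, provided that the blocks of the smallest kind do not account
for half of the output. That is the condition on the time.

A halting machine repeats no configuration and has only `2 ^ O(s)` configurations of space `s`, so
during its at least `n ^ 2` steps its space is mostly `Ω(log n)`. Hence its cumulative memory is
`Ω(T * log n)`, and if `T * S` were too small the condition on the time would be satisfied.
-/

section CoordinateCounting

variable {F ι κ m : Type*} [Field F]

theorem exists_determining_coordinates (V : Submodule F (ι → F)) [FiniteDimensional F V] :
    ∃ I : Finset ι, I.card ≤ Module.finrank F V ∧ ∀ v ∈ V, (∀ i ∈ I, v i = 0) → v = 0 := by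
  let coord : ι → Module.Dual F V := fun i => LinearMap.proj i ∘ₗ V.subtype
  obtain ⟨β, b, hb, hspan, hli⟩ := exists_linearIndependent' F coord
  have := hli.finite_of_isNoetherian
  have := Fintype.ofFinite β
  refine ⟨Finset.univ.map ⟨b, hb⟩, ?_, fun v hv hvanish => funext fun i => ?_⟩
  · rw [Finset.card_map, Finset.card_univ, ← Subspace.dual_finrank_eq]
    exact hli.fintype_card_le_finrank
  · have hker : Submodule.span F (Set.range coord) ≤
        LinearMap.ker (Module.Dual.eval F V ⟨v, hv⟩) := by
      rw [← hspan, Submodule.span_le]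
      rintro _ ⟨j, rfl⟩
      exact hvanish (b j) (by simp)
    exact hker (Submodule.subset_span ⟨i, rfl⟩)

theorem card_le_pow_finrank_of_sub_mem {D : Finset F} (hD : 1 ≤ D.card) (V : Submodule F (ι → F))
    [FiniteDimensional F V] (S : Finset (ι → D))
    (hS : ∀ a ∈ S, ∀ b ∈ S, (fun i => (a i : F) - b i) ∈ V) :
    S.card ≤ D.card ^ Module.finrank F V := by
  classical
  obtain ⟨I, hI, hdet⟩ := exists_determining_coordinates V
  have hrestrict : S.card ≤ (Finset.univ : Finset (I → D)).card := by
    refine Finset.card_le_card_of_injOn (fun a i => a i) (fun a _ => Finset.mem_univ _) ?_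
    intro a ha b hb hab
    have hzero := hdet _ (hS a ha b hb) fun i hi =>
      sub_eq_zero.2 (congrArg Subtype.val (congrFun hab ⟨i, hi⟩))
    exact funext fun i => Subtype.ext (sub_eq_zero.1 (congrFun hzero i))
  refine hrestrict.trans ?_
  rw [Finset.card_univ, Fintype.card_fun, Fintype.card_coe, Fintype.card_coe]
  exact Nat.pow_le_pow_right hD hI

theorem extendByZero_restrict (p : ι → Prop) (v : ι → F) (hv : ∀ i, ¬ p i → v i = 0) :
    Function.ExtendByZero.linearMap F (Subtype.val : {i // p i} → ι) (fun i => v i) = v := by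
  funext i
  by_cases hi : p i
  · exact Subtype.val_injective.extend_apply (fun i : {i // p i} => v i) 0 ⟨i, hi⟩
  · rw [hv i hi]
    have hnot : ¬ ∃ j : {i // p i}, (j : ι) = i := by
      rintro ⟨j, rfl⟩
      exact hi j.2
    exact Function.extend_apply' (fun i : {i // p i} => v i) (0 : ι → F) i hnot

/-- The rank of the submatrix of `M` formed by the rows outside `W` and the columns in `O`. -/
noncomputable def rankOff (M : Matrix m κ F) (W : Finset m) (O : Finset κ) : ℕ :=
  (M.submatrix (Subtype.val : {u // u ∉ W} → m) (Subtype.val : O → κ)).rank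

variable [Fintype m] [DecidableEq m]

open scoped Classical in
theorem card_solutions_mul_le {D : Finset F} (hD : 1 ≤ D.card) (M : Matrix m κ F) (W : Finset m)
    (O : Finset κ) (a₀ : m → D) (y : κ → F) :
    (Finset.univ.filter fun a : m → D =>
        (∀ u ∈ W, a u = a₀ u) ∧ ∀ j ∈ O, ∑ u, (a u : F) * M u j = y j).card *
      (D.card ^ rankOff M W O * D.card ^ W.card) ≤ D.card ^ Fintype.card m := by
  set N := M.submatrix (Subtype.val : {u // u ∉ W} → m) (Subtype.val : O → κ)
  let V : Submodule F (m → F) := (LinearMap.ker N.transpose.mulVecLin).map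
    (Function.ExtendByZero.linearMap F (Subtype.val : {u // u ∉ W} → m))
  have hV : Module.finrank F V + rankOff M W O + W.card ≤ Fintype.card m := by
    have hmap : Module.finrank F V ≤ Module.finrank F (LinearMap.ker N.transpose.mulVecLin) :=
      Submodule.finrank_map_le _ _
    have hnullity := LinearMap.finrank_range_add_finrank_ker N.transpose.mulVecLin
    have hcompl : Fintype.card {u // u ∉ W} = Fintype.card m - W.card := by
      rw [Fintype.card_subtype_compl, Fintype.card_coe]
    have hrank : Module.finrank F (LinearMap.range N.transpose.mulVecLin) = rankOff M W O :=
      Matrix.rank_transpose N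
    rw [hrank, Module.finrank_fintype_fun_eq_card, hcompl] at hnullity
    have := W.card_le_univ
    lia
  refine (Nat.mul_le_mul_right _ (card_le_pow_finrank_of_sub_mem hD V _ ?_)).trans ?_
  · intro a ha b hb
    simp only [Finset.mem_filter_univ] at ha hb
    have hsupp : ∀ u, ¬ u ∉ W → (a u : F) - b u = 0 := fun u hu => by
      rw [ha.1 u (not_not.1 hu), hb.1 u (not_not.1 hu), sub_self]
    refine ⟨fun u => a u - b u, funext fun j => ?_, extendByZero_restrict _ _ hsupp⟩
    have hsum : ∑ u, ((a u : F) - b u) * M u j = 0 := by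
      simp only [sub_mul, Finset.sum_sub_distrib, ha.2 j j.2, hb.2 j j.2, sub_self]
    calc ∑ u : {u // u ∉ W}, M u j * ((a u : F) - b u)
        = ∑ u with u ∉ W, ((a u : F) - b u) * M u j := by
          simp only [mul_comm (M _ _)]
          exact (Finset.sum_subtype _ (by simp) fun u => ((a u : F) - b u) * M u j).symm
      _ = ∑ u, ((a u : F) - b u) * M u j := by
          refine Finset.sum_filter_of_ne fun u _ hne hu => hne ?_
          rw [hsupp u (not_not.2 hu), zero_mul]
      _ = 0 := hsum
  · rw [← pow_add, ← pow_add, ← add_assoc]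
    exact Nat.pow_le_pow_right hD hV

open scoped Classical in
theorem card_agree_range_le {D : Finset F} (hD : 1 ≤ D.card) [Fintype κ] (M : Matrix m κ F)
    (W : Finset m) :
    (Finset.univ.filter fun a : m → D => ∃ b : κ → F, ∀ u ∉ W, (a u : F) = M.mulVec b u).card ≤
      D.card ^ (W.card + Fintype.card κ) := by
  let extend := Function.ExtendByZero.linearMap F (Subtype.val : {u // u ∈ W} → m)
  let V : Submodule F (m → F) := LinearMap.range extend ⊔ LinearMap.range M.mulVecLin
  have hV : Module.finrank F V ≤ W.card + Fintype.card κ := by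
    refine (Submodule.finrank_add_le_finrank_add_finrank _ _).trans (add_le_add ?_ ?_)
    · refine (LinearMap.finrank_range_le extend).trans ?_
      rw [Module.finrank_fintype_fun_eq_card, Fintype.card_coe]
    · exact (LinearMap.finrank_range_le M.mulVecLin).trans
        (Module.finrank_fintype_fun_eq_card F).le
  refine (card_le_pow_finrank_of_sub_mem hD V _ ?_).trans (Nat.pow_le_pow_right hD hV)
  intro a ha b hb
  obtain ⟨β, hβ⟩ := (Finset.mem_filter_univ _).1 ha
  obtain ⟨γ, hγ⟩ := (Finset.mem_filter_univ _).1 hb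
  let v : m → F := fun u => (a u : F) - b u - M.mulVec (β - γ) u
  have hv : extend (fun u => v u) = v := extendByZero_restrict _ _ fun u hu => by
    simp only [v, hβ u hu, hγ u hu, Matrix.mulVec_sub, Pi.sub_apply, sub_self]
  refine Submodule.mem_sup.2 ⟨v, ⟨_, hv⟩, M.mulVec (β - γ), ⟨β - γ, rfl⟩, ?_⟩
  funext u
  simp only [v, Pi.add_apply, sub_add_cancel]

end CoordinateCounting

section FiniteCounting

theorem card_mul_le_of_fibers {β γ : Type*} [DecidableEq γ] (S : Finset β) (T : Finset γ)
    (f : β → γ) (hf : ∀ x ∈ S, f x ∈ T) {m t : ℕ}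
    (hfiber : ∀ b ∈ T, (S.filter fun x => f x = b).card * m ≤ t) : S.card * m ≤ T.card * t := by
  rw [Finset.card_eq_sum_card_fiberwise hf, Finset.sum_mul, ← smul_eq_mul]
  exact Finset.sum_le_card_nsmul _ _ _ hfiber

theorem card_agree_mul {ι δ : Type*} [Fintype ι] [DecidableEq ι] [Fintype δ] [DecidableEq δ]
    (Q : Finset ι) (x₀ : ι → δ) :
    (Finset.univ.filter fun x : ι → δ => ∀ i ∈ Q, x i = x₀ i).card * Fintype.card δ ^ Q.card =
      Fintype.card δ ^ Fintype.card ι := by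
  have hpi : (Finset.univ.filter fun x : ι → δ => ∀ i ∈ Q, x i = x₀ i) =
      Fintype.piFinset fun i => if i ∈ Q then {x₀ i} else Finset.univ := by
    ext x
    simp only [Finset.mem_filter_univ, Fintype.mem_piFinset]
    refine forall_congr' fun i => ?_
    split_ifs with hi <;> simp [hi]
  have hfree : (Finset.univ.filter fun x : ι → δ => ∀ i ∈ Q, x i = x₀ i).card =
      Fintype.card δ ^ (Qᶜ).card := by
    rw [hpi, Fintype.card_piFinset, ← Finset.prod_const, ← Finset.prod_filter_mul_prod_filter_not
      Finset.univ (· ∈ Q), Finset.filter_not, Finset.filter_univ_mem, ← Finset.compl_eq_univ_sdiff]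
    rw [Finset.prod_eq_one fun i hi => by rw [if_pos hi, Finset.card_singleton], one_mul]
    exact Finset.prod_congr rfl fun i hi => by rw [if_neg (Finset.mem_compl.1 hi), Finset.card_univ]
  rw [hfree, ← pow_add, Finset.card_compl_add_card]

variable {α β : Type*} [Fintype β] [DecidableEq α] [DecidableEq β]

/-- The `i`-th row of a set of matrix positions. -/
def row (Q : Finset (α × β)) (i : α) : Finset β :=
  Finset.univ.filter fun k => (i, k) ∈ Q

@[simp]
theorem mem_row {Q : Finset (α × β)} {i : α} {k : β} : k ∈ row Q i ↔ (i, k) ∈ Q :=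
  Finset.mem_filter_univ k

theorem sum_card_row [Fintype α] (Q : Finset (α × β)) : ∑ i, (row Q i).card = Q.card := by
  simp only [row, Finset.card_filter]
  rw [← Fintype.sum_prod_type fun p => if p ∈ Q then 1 else 0, ← Finset.card_filter,
    Finset.filter_univ_mem]

theorem card_heavy_rows_mul_le [Fintype α] (Q : Finset (α × β)) (h : ℕ) :
    (Finset.univ.filter fun i => h < (row Q i).card).card * (h + 1) ≤ Q.card := by
  rw [← sum_card_row Q, ← smul_eq_mul]
  refine (Finset.card_nsmul_le_sum _ _ _ fun i hi => ?_).trans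
    (Finset.sum_le_sum_of_subset (Finset.filter_subset _ _))
  exact (Finset.mem_filter_univ i).1 hi

end FiniteCounting

section Rigidity

variable {F α β γ : Type*} [Field F]

/-- Matrix rigidity: deleting any `h` rows leaves every set of at most `h` columns with rank at
least half its size. -/
def Rigid (h : ℕ) (M : Matrix β γ F) : Prop :=
  ∀ (W : Finset β) (O : Finset γ), W.card ≤ h → O.card ≤ h → O.card ≤ 2 * rankOff M W O

theorem Rigid.exists_subset_card_le_rankOff [Fintype γ] {h : ℕ} {M : Matrix β γ F}
    (hM : Rigid h M) (hγ : Fintype.card γ ≤ 128 * h) {W : Finset β} (hW : W.card ≤ h)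
    (O : Finset γ) : ∃ O' ⊆ O, O.card ≤ 256 * rankOff M W O' := by
  obtain ⟨O', hO', hcard⟩ := Finset.exists_subset_card_eq (min_le_left O.card h)
  refine ⟨O', hO', ?_⟩
  have hrank := hM W O' hW (hcard ▸ min_le_right _ _)
  have := O.card_le_univ
  lia

variable [Fintype α] [Fintype β] [Fintype γ] [DecidableEq α] [DecidableEq β] [DecidableEq γ]

open scoped Classical in
theorem card_left_factors_mul_le {D : Finset F} (hD : 1 ≤ D.card) {h : ℕ}
    (hγ : Fintype.card γ ≤ 128 * h) {N : Matrix β γ F} (hN : Rigid h N) (Q : Finset (α × β))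
    (a₀ : α → β → D) (O : Finset (α × γ)) (hO : ∀ p ∈ O, (row Q p.1).card ≤ h) (y : α → γ → F)
    {R : ℕ} (hR : 256 * R < O.card + 256) :
    (Finset.univ.filter fun a : α → β → D => (∀ p ∈ Q, a p.1 p.2 = a₀ p.1 p.2) ∧
        ∀ p ∈ O, ∑ k, (a p.1 k : F) * N k p.2 = y p.1 p.2).card *
      (D.card ^ R * D.card ^ Q.card) ≤ (D.card ^ Fintype.card β) ^ Fintype.card α := by
  have hrow : ∀ i, ∃ O' ⊆ row O i, (row O i).card ≤ 256 * rankOff N (row Q i) O' := fun i => by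
    obtain hi | ⟨k, hk⟩ := (row O i).eq_empty_or_nonempty
    · exact ⟨∅, Finset.empty_subset _, by simp [hi]⟩
    · exact hN.exists_subset_card_le_rankOff hγ (hO (i, k) (mem_row.1 hk)) _
  choose O' hO' hrank using hrow
  let S : α → Finset (β → D) := fun i => Finset.univ.filter fun a : β → D =>
    (∀ u ∈ row Q i, a u = a₀ i u) ∧ ∀ j ∈ O' i, ∑ u, (a u : F) * N u j = y i j
  have hS : ∀ i, (S i).card * (D.card ^ rankOff N (row Q i) (O' i) * D.card ^ (row Q i).card) ≤
      D.card ^ Fintype.card β := fun i => by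
    convert card_solutions_mul_le hD N (row Q i) (O' i) (a₀ i) (y i)
  have hR' : R ≤ ∑ i, rankOff N (row Q i) (O' i) := by
    have : ∑ i, (row O i).card ≤ ∑ i, 256 * rankOff N (row Q i) (O' i) :=
      Finset.sum_le_sum fun i _ => hrank i
    rw [sum_card_row, ← Finset.mul_sum] at this
    lia
  calc _ ≤ (Fintype.piFinset S).card * (D.card ^ (∑ i, rankOff N (row Q i) (O' i)) *
          D.card ^ ∑ i, (row Q i).card) := by
        rw [sum_card_row]
        gcongr
        intro a ha
        obtain ⟨hagree, hsolve⟩ := (Finset.mem_filter_univ _).1 ha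
        refine Fintype.mem_piFinset.2 fun i => (Finset.mem_filter_univ _).2 ⟨fun u hu => ?_,
          fun j hj => ?_⟩
        · exact hagree (i, u) (mem_row.1 hu)
        · exact hsolve (i, j) (mem_row.1 (hO' i hj))
    _ = ∏ i, ((S i).card * (D.card ^ rankOff N (row Q i) (O' i) * D.card ^ (row Q i).card)) := by
        rw [Fintype.card_piFinset, Finset.prod_mul_distrib, Finset.prod_mul_distrib,
          Finset.prod_pow_eq_pow_sum, Finset.prod_pow_eq_pow_sum]
    _ ≤ ∏ _i : α, D.card ^ Fintype.card β := Finset.prod_le_prod' fun i _ => hS i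
    _ = (D.card ^ Fintype.card β) ^ Fintype.card α := Finset.prod_const _

end Rigidity

namespace MatMul

variable {F : Type*} [Field F] {n : ℕ} {D : Finset F}

/-- The involution of the entries under which the pair `(A, B)` becomes `(Bᵀ, Aᵀ)`. -/
def flip : Idx n ≃ Idx n :=
  (Equiv.sumComm _ _).trans (Equiv.sumCongr (Equiv.prodComm _ _) (Equiv.prodComm _ _))

theorem flip_symm : (flip : Idx n ≃ Idx n).symm = flip :=
  Equiv.ext fun i => by cases i <;> rfl

theorem card_toLeft_map_flip (Q : Finset (Idx n)) :
    (Q.map flip.toEmbedding).toLeft.card = Q.toRight.card := by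
  refine (Finset.card_map (Equiv.prodComm (Fin n) (Fin n)).toEmbedding).symm.trans
    (congrArg _ (Finset.ext fun p => ?_))
  simp [flip, Finset.mem_map_equiv]

theorem product_flip (x : Idx n → D) (p : Fin n × Fin n) :
    product (x ∘ flip) p = product x p.swap := by
  rw [product, product, Matrix.mul_apply, Matrix.mul_apply]
  exact Finset.sum_congr rfl fun _ _ => mul_comm _ _

/-- Both factors are rigid, the first one after transposition, so that either of the two can be
solved for when the other one and some entries of the product are known. -/
def RigidPair (h : ℕ) (x : Idx n → D) : Prop :=
  Rigid h (right x) ∧ Rigid h (left x).transpose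

theorem RigidPair.flip {h : ℕ} {x : Idx n → D} (hx : RigidPair h x) : RigidPair h (x ∘ flip) :=
  ⟨hx.2, hx.1⟩

open scoped Classical in
theorem card_same_right_factor_mul_le (hD : 1 ≤ D.card) {h : ℕ} (hn : n ≤ 128 * h)
    (Q : Finset (Idx n)) (x₀ : Idx n → D) (O : Finset (Fin n × Fin n)) (y : Fin n × Fin n → F)
    {R : ℕ} (hO : ∀ p ∈ O, (row Q.toLeft p.1).card ≤ h) (hR : 256 * R < O.card + 256)
    {b : Fin n × Fin n → D} (hb : Rigid h (Matrix.of fun i j => (b (i, j) : F))) :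
    (Finset.univ.filter fun x : Idx n → D => (∀ i ∈ Q, x i = x₀ i) ∧ (fun p => x (.inr p)) = b ∧
        ∀ p ∈ O, product x p = y p).card * (D.card ^ R * D.card ^ Q.toLeft.card) ≤
      D.card ^ (n * n) := by
  have hcount := card_left_factors_mul_le hD (by simpa using hn) hb Q.toLeft
    (fun i k => x₀ (.inl (i, k))) O hO (fun i j => y (i, j)) hR
  rw [Fintype.card_fin, ← pow_mul] at hcount
  refine (Nat.mul_le_mul_right _ (Finset.card_le_card_of_injOn (fun x i k => x (.inl (i, k)))
    (fun x hx => ?_) fun x hx x' hx' heq => ?_)).trans hcount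
  · obtain ⟨hagree, rfl, hprod⟩ := (Finset.mem_filter_univ x).1 hx
    exact (Finset.mem_filter_univ _).2 ⟨fun p hp => hagree _ (Finset.mem_toLeft.1 hp),
      fun p hp => hprod p hp⟩
  · have hright := ((Finset.mem_filter_univ x).1 hx).2.1.trans
      ((Finset.mem_filter_univ x').1 hx').2.1.symm
    funext i
    rcases i with ⟨i, k⟩ | p
    · exact congrFun (congrFun heq i) k
    · exact congrFun hright p

open scoped Classical in
theorem card_correct_mul_le_of_light_rows (hD : 1 ≤ D.card) {h : ℕ} (hn : n ≤ 128 * h)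
    (Q : Finset (Idx n)) (x₀ : Idx n → D) (O : Finset (Fin n × Fin n)) (y : Fin n × Fin n → F)
    {R : ℕ} (hO : ∀ p ∈ O, (row Q.toLeft p.1).card ≤ h) (hR : 256 * R < O.card + 256) :
    (Finset.univ.filter fun x : Idx n → D =>
        (∀ i ∈ Q, x i = x₀ i) ∧ RigidPair h x ∧ ∀ p ∈ O, product x p = y p).card *
      (D.card ^ R * D.card ^ Q.card) ≤ D.card ^ (n * n) * D.card ^ (n * n) := by
  set S := Finset.univ.filter fun x : Idx n → D =>
    (∀ i ∈ Q, x i = x₀ i) ∧ RigidPair h x ∧ ∀ p ∈ O, product x p = y p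
  let T := Finset.univ.filter fun b : Fin n × Fin n → D => ∀ p ∈ Q.toRight, b p = x₀ (.inr p)
  have hT : T.card * D.card ^ Q.toRight.card = D.card ^ (n * n) := by
    convert card_agree_mul Q.toRight fun p => x₀ (.inr p) <;> simp
  have hST : S.card * (D.card ^ R * D.card ^ Q.toLeft.card) ≤ T.card * D.card ^ (n * n) := by
    refine card_mul_le_of_fibers S T (fun x p => x (.inr p)) (fun x hx => ?_) fun b _ => ?_
    · exact (Finset.mem_filter_univ _).2 fun p hp =>
        ((Finset.mem_filter_univ x).1 hx).1 _ (Finset.mem_toRight.1 hp)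
    by_cases hb : Rigid h (Matrix.of fun i j => (b (i, j) : F))
    · refine (Nat.mul_le_mul_right _ (Finset.card_le_card fun x hx => ?_)).trans
        (card_same_right_factor_mul_le hD hn Q x₀ O y hO hR hb)
      obtain ⟨hxS, hright⟩ := Finset.mem_filter.1 hx
      obtain ⟨hagree, -, hprod⟩ := (Finset.mem_filter_univ x).1 hxS
      exact (Finset.mem_filter_univ x).2 ⟨hagree, hright, hprod⟩
    · rw [Finset.filter_eq_empty_iff.2, Finset.card_empty, zero_mul]
      · exact Nat.zero_le _
      · rintro x hx rfl
        exact hb ((Finset.mem_filter_univ x).1 hx).2.1.1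
  calc S.card * (D.card ^ R * D.card ^ Q.card)
      = S.card * (D.card ^ R * D.card ^ Q.toLeft.card) * D.card ^ Q.toRight.card := by
        rw [← Finset.card_toLeft_add_card_toRight (u := Q), pow_add]
        ring
    _ ≤ T.card * D.card ^ (n * n) * D.card ^ Q.toRight.card := Nat.mul_le_mul_right _ hST
    _ = D.card ^ (n * n) * D.card ^ (n * n) := by rw [mul_right_comm, hT]

theorem four_mul_card_heavy_rows_mul_le {h k : ℕ} {A B : Finset (Fin n × Fin n)}
    (hAB : (A.card + B.card) ^ 2 ≤ h ^ 2 * k) :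
    4 * ((Finset.univ.filter fun i => h < (row A i).card).card *
      (Finset.univ.filter fun j => h < (row B j).card).card) ≤ k := by
  set HA := Finset.univ.filter fun i => h < (row A i).card
  set HB := Finset.univ.filter fun j => h < (row B j).card
  refine Nat.le_of_mul_le_mul_left ?_ (show 0 < (h + 1) ^ 2 by positivity)
  calc (h + 1) ^ 2 * (4 * (HA.card * HB.card))
      = 4 * ((HA.card * (h + 1)) * (HB.card * (h + 1))) := by ring
    _ ≤ 4 * (A.card * B.card) := by
      gcongr
      exacts [card_heavy_rows_mul_le A h, card_heavy_rows_mul_le B h]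
    _ ≤ (A.card + B.card) ^ 2 := by rw [← mul_assoc]; exact four_mul_le_sq_add _ _
    _ ≤ h ^ 2 * k := hAB
    _ ≤ (h + 1) ^ 2 * k := by gcongr; lia

theorem exists_light_entries {h k : ℕ} (Q : Finset (Idx n)) (O : Finset (Fin n × Fin n))
    (hk : k ≤ O.card) (hQ : Q.card ^ 2 ≤ h ^ 2 * k) :
    (∃ O' ⊆ O, k ≤ 4 * O'.card ∧ ∀ p ∈ O', (row Q.toLeft p.1).card ≤ h) ∨
      ∃ O' ⊆ O, k ≤ 4 * O'.card ∧
        ∀ p ∈ O', (row (Q.map flip.toEmbedding).toLeft p.2).card ≤ h := by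
  let HA := Finset.univ.filter fun i => h < (row Q.toLeft i).card
  let HB := Finset.univ.filter fun j => h < (row (Q.map flip.toEmbedding).toLeft j).card
  have hheavy : 4 * (HA.card * HB.card) ≤ k := four_mul_card_heavy_rows_mul_le <| by
    rwa [card_toLeft_map_flip, Finset.card_toLeft_add_card_toRight]
  let OA := O.filter fun p => p.1 ∉ HA
  let OB := O.filter fun p => p.2 ∉ HB
  have hcover : O.card ≤ OA.card + OB.card + HA.card * HB.card := by
    have hsub : O ⊆ (OA ∪ OB) ∪ HA ×ˢ HB := fun p hp => by
      simp only [Finset.mem_union, OA, OB, Finset.mem_filter, Finset.mem_product, hp, true_and]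
      tauto
    refine (Finset.card_le_card hsub).trans ((Finset.card_union_le _ _).trans ?_)
    rw [Finset.card_product]
    exact Nat.add_le_add_right (Finset.card_union_le _ _) _
  rcases (by lia : k ≤ 4 * OA.card ∨ k ≤ 4 * OB.card) with hmany | hmany
  · refine .inl ⟨OA, Finset.filter_subset _ _, hmany, fun p hp => ?_⟩
    simpa [HA] using (Finset.mem_filter.1 hp).2
  · refine .inr ⟨OB, Finset.filter_subset _ _, hmany, fun p hp => ?_⟩
    simpa [HB] using (Finset.mem_filter.1 hp).2

open scoped Classical in
theorem card_correct_mul_le (hD : 1 ≤ D.card) {h : ℕ} (hn : n ≤ 128 * h) (Q : Finset (Idx n))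
    (x₀ : Idx n → D) (O : Finset (Fin n × Fin n)) (y : Fin n × Fin n → F) {k R : ℕ}
    (hk : k ≤ O.card) (hQ : Q.card ^ 2 ≤ h ^ 2 * k) (hR : 1024 * R < k + 1024) :
    (Finset.univ.filter fun x : Idx n → D =>
        (∀ i ∈ Q, x i = x₀ i) ∧ RigidPair h x ∧ ∀ p ∈ O, product x p = y p).card *
      (D.card ^ R * D.card ^ Q.card) ≤ D.card ^ (n * n) * D.card ^ (n * n) := by
  obtain ⟨O', hO', hmany, hlight⟩ | ⟨O', hO', hmany, hlight⟩ := exists_light_entries Q O hk hQ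
  · refine (Nat.mul_le_mul_right _ (Finset.card_le_card fun x hx => ?_)).trans
      (card_correct_mul_le_of_light_rows hD hn Q x₀ O' y hlight (by lia))
    obtain ⟨hagree, hrigid, hprod⟩ := (Finset.mem_filter_univ x).1 hx
    exact (Finset.mem_filter_univ x).2 ⟨hagree, hrigid, fun p hp => hprod p (hO' hp)⟩
  · have hcount := card_correct_mul_le_of_light_rows hD hn (Q.map flip.toEmbedding)
      (x₀ ∘ flip) (O'.map (Equiv.prodComm _ _).toEmbedding) (fun p => y p.swap) (R := R)
      (fun p hp => hlight p.swap (Finset.mem_map_equiv.1 hp)) (by rw [Finset.card_map]; lia)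
    rw [Finset.card_map] at hcount
    refine (Nat.mul_le_mul_right _ (Finset.card_le_card_of_injOn (· ∘ flip) (fun x hx => ?_)
      fun x _ x' _ heq => flip.surjective.injective_comp_right heq)).trans hcount
    obtain ⟨hagree, hrigid, hprod⟩ := (Finset.mem_filter_univ x).1 hx
    refine (Finset.mem_filter_univ _).2 ⟨fun i hi => ?_, hrigid.flip, fun p hp => ?_⟩
    · exact hagree _ (flip_symm ▸ Finset.mem_map_equiv.1 hi)
    · rw [product_flip]
      exact hprod _ (hO' (Finset.mem_map_equiv.1 hp))

end MatMul

section RandomMatrices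

variable {F m κ : Type*} [Field F]

/-- Outside the rows `W`, the columns in `R` are linear combinations of the columns in `J`. -/
def ColumnsSpanned (M : Matrix m κ F) (W : Finset m) (J R : Finset κ) : Prop :=
  ∀ r ∈ R, ∃ b : J → F, ∀ u ∉ W, M u r = (M.submatrix id (Subtype.val : J → κ)).mulVec b u

theorem exists_columnsSpanned_of_not_rigid {h : ℕ} {M : Matrix m κ F} (hM : ¬ Rigid h M) :
    ∃ (W : Finset m) (J R : Finset κ), W.card ≤ h ∧ R.card ≤ h ∧ J.card < R.card ∧
      Disjoint J R ∧ ColumnsSpanned M W J R := by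
  classical
  unfold Rigid at hM
  push Not at hM
  obtain ⟨W, O, hW, hO, hrank⟩ := hM
  let column : κ → ({u // u ∉ W} → F) := fun j u => M u j
  obtain ⟨b, hbO, -, hspan, hli⟩ := exists_linearIndepOn_extension (K := F) (v := column)
    (s := ∅) (t := (O : Set κ)) (linearIndepOn_empty _ _) (Set.empty_subset _)
  obtain ⟨J, rfl⟩ := (O.finite_toSet.subset hbO).exists_finset_coe
  have hJO : J ⊆ O := Finset.coe_subset.1 hbO
  have hJ : J.card ≤ rankOff M W O := by
    rw [rankOff, Matrix.rank_eq_finrank_span_cols, ← Fintype.card_coe J,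
      ← finrank_span_eq_card (show LinearIndependent F fun j : J => column j from hli)]
    have := FiniteDimensional.span_of_finite F
      (Set.finite_range (M.submatrix (Subtype.val : {u // u ∉ W} → m) (Subtype.val : O → κ)).col)
    refine Submodule.finrank_mono (Submodule.span_mono ?_)
    rintro _ ⟨j, rfl⟩
    exact ⟨⟨j, hJO j.2⟩, rfl⟩
  have hcard := Finset.card_sdiff_add_card_eq_card hJO
  refine ⟨W, J, O \ J, hW, (Finset.card_le_card Finset.sdiff_subset).trans hO, by lia,
    Finset.disjoint_sdiff, fun r hr => ?_⟩
  have hr := hspan ⟨r, (Finset.mem_sdiff.1 hr).1, rfl⟩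
  rw [Set.image_eq_range] at hr
  obtain ⟨c, hc⟩ := (Submodule.mem_span_range_iff_exists_fun F).1 hr
  refine ⟨c, fun u hu => ?_⟩
  rw [show M u r = column r ⟨u, hu⟩ from rfl, ← hc, Finset.sum_apply]
  exact Finset.sum_congr rfl fun j _ => mul_comm _ _

variable [DecidableEq κ]

/-- Weight of a triple `(W, J, R)` in the union bound over the linear relations between columns:
at least the probability of the relation when `z` is `(1 / 2) ^ e`, and summable in closed form. -/
noncomputable def relationWeight (h : ℕ) (z : ℝ) (t : Finset m × Finset κ × Finset κ) : ℝ :=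
  (16 ^ h * (1 / 16) ^ t.1.card) * (z ^ t.2.1.card * if t.2.2 = ∅ then 0 else z ^ t.2.2.card)

theorem relationWeight_nonneg (h : ℕ) {z : ℝ} (hz : 0 ≤ z) (t : Finset m × Finset κ × Finset κ) :
    0 ≤ relationWeight h z t := by
  unfold relationWeight
  split_ifs <;> positivity

theorem sum_pow_card (ι : Type*) [Fintype ι] (t : ℝ) :
    ∑ s : Finset ι, t ^ s.card = (1 + t) ^ Fintype.card ι := by
  simpa [add_comm] using Fintype.sum_pow_mul_eq_add_pow ι t 1

theorem sum_relationWeight [Fintype m] [Fintype κ] (h : ℕ) (z : ℝ) :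
    ∑ t : Finset m × Finset κ × Finset κ, relationWeight h z t =
      (16 ^ h * (17 / 16) ^ Fintype.card m) *
        ((1 + z) ^ Fintype.card κ * ((1 + z) ^ Fintype.card κ - 1)) := by
  have hnonempty : ∑ s : Finset κ, (if s = ∅ then 0 else z ^ s.card) =
      (1 + z) ^ Fintype.card κ - 1 := by
    have hite (s : Finset κ) : (if s = ∅ then 0 else z ^ s.card) =
        z ^ s.card - if s = ∅ then 1 else 0 := by
      split_ifs with hs <;> simp [hs]
    simp only [hite, Finset.sum_sub_distrib, sum_pow_card, Finset.sum_ite_eq', Finset.mem_univ,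
      if_true]
  simp only [relationWeight, Fintype.sum_prod_type, ← Finset.mul_sum, ← Finset.sum_mul,
    sum_pow_card, hnonempty]
  norm_num

theorem one_le_relationWeight_mul {d : ℝ} (hd : 2 ≤ d) (e : ℕ) {h : ℕ} {W : Finset m}
    {J R : Finset κ} (hW : W.card ≤ h) (hJR : J.card < R.card) :
    1 ≤ relationWeight h ((1 / 2) ^ e) (W, J, R) * d ^ (2 * e * R.card) := by
  have hR : R ≠ ∅ := by
    rintro rfl
    simp at hJR
  have hrows : (1 : ℝ) ≤ 16 ^ h * (1 / 16) ^ W.card := by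
    rw [one_div, inv_pow, ← div_eq_mul_inv, one_le_div (by positivity)]
    exact pow_le_pow_right₀ (by norm_num) hW
  have hcols : 1 ≤ ((1 / 2 : ℝ) ^ e) ^ (J.card + R.card) * d ^ (2 * e * R.card) := by
    calc (1 : ℝ) = ((1 / 2) ^ e) ^ (2 * R.card) * 2 ^ (2 * e * R.card) := by
          rw [← pow_mul, show e * (2 * R.card) = 2 * e * R.card by ring, ← mul_pow]
          norm_num
      _ ≤ ((1 / 2) ^ e) ^ (J.card + R.card) * d ^ (2 * e * R.card) :=
          mul_le_mul (pow_le_pow_of_le_one (by positivity)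
              (pow_le_one₀ (by norm_num) (by norm_num)) (by lia))
            (pow_le_pow_left₀ (by norm_num) hd _) (by positivity) (by positivity)
  rw [relationWeight, if_neg hR, ← pow_add, mul_assoc]
  exact one_le_mul_of_one_le_of_one_le hrows hcols

variable [Fintype m] [DecidableEq m] [Fintype κ]

open scoped Classical in
theorem card_columnsSpanned_extending_le {D : Finset F} (hD : 1 ≤ D.card) (W : Finset m)
    {J R : Finset κ} (hdisj : Disjoint J R) (b : {j // j ∉ R} → m → D) :
    (Finset.univ.filter fun a : m → κ → D => (fun (j : {j // j ∉ R}) i => a i j) = b ∧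
        ColumnsSpanned (Matrix.of fun i j => (a i j : F)) W J R).card ≤
      (D.card ^ (W.card + J.card)) ^ R.card := by
  let N : Matrix m J F := Matrix.of fun i j => (b ⟨j, Finset.disjoint_left.1 hdisj j.2⟩ i : F)
  let P := Finset.univ.filter fun v : m → D => ∃ c : J → F, ∀ u ∉ W, (v u : F) = N.mulVec c u
  calc _ ≤ (Fintype.piFinset fun _ : R => P).card := by
        refine Finset.card_le_card_of_injOn (fun a r i => a i r)
          (fun a ha => Fintype.mem_piFinset.2 fun r => ?_) fun a ha a' ha' heq => ?_
        · obtain ⟨rfl, hspan⟩ := (Finset.mem_filter_univ a).1 ha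
          obtain ⟨c, hc⟩ := hspan r r.2
          exact (Finset.mem_filter_univ _).2 ⟨c, hc⟩
        · have hcols := ((Finset.mem_filter_univ a).1 ha).1.trans
            ((Finset.mem_filter_univ a').1 ha').1.symm
          funext i j
          by_cases hj : j ∈ R
          · exact congrFun (congrFun heq ⟨j, hj⟩) i
          · exact congrFun (congrFun hcols ⟨j, hj⟩) i
    _ = P.card ^ R.card := by
        rw [Fintype.card_piFinset, Finset.prod_const, Finset.card_univ, Fintype.card_coe]
    _ ≤ (D.card ^ (W.card + J.card)) ^ R.card := by
        refine Nat.pow_le_pow_left ?_ _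
        rw [← Fintype.card_coe J]
        exact card_agree_range_le hD N W

open scoped Classical in
theorem card_columnsSpanned_mul_le {D : Finset F} (hD : 1 ≤ D.card) (W : Finset m)
    {J R : Finset κ} (hdisj : Disjoint J R) {s : ℕ} (hs : W.card + J.card + s ≤ Fintype.card m) :
    (Finset.univ.filter fun a : m → κ → D =>
        ColumnsSpanned (Matrix.of fun i j => (a i j : F)) W J R).card * D.card ^ (s * R.card) ≤
      (D.card ^ Fintype.card m) ^ Fintype.card κ := by
  set S := Finset.univ.filter fun a : m → κ → D =>
    ColumnsSpanned (Matrix.of fun i j => (a i j : F)) W J R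
  refine (card_mul_le_of_fibers S (Finset.univ : Finset ({j // j ∉ R} → m → D))
    (fun a j i => a i j) (fun _ _ => Finset.mem_univ _)
    (t := (D.card ^ Fintype.card m) ^ R.card) fun b _ => ?_).trans_eq ?_
  · calc _ ≤ (D.card ^ (W.card + J.card)) ^ R.card * D.card ^ (s * R.card) := by
          refine Nat.mul_le_mul_right _ (le_trans (Finset.card_le_card fun a ha => ?_)
            (card_columnsSpanned_extending_le hD W hdisj b))
          obtain ⟨haS, hcols⟩ := Finset.mem_filter.1 ha
          exact (Finset.mem_filter_univ a).2 ⟨hcols, (Finset.mem_filter_univ a).1 haS⟩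
      _ = (D.card ^ (W.card + J.card + s)) ^ R.card := by rw [pow_mul, ← mul_pow, ← pow_add]
      _ ≤ (D.card ^ Fintype.card m) ^ R.card :=
          Nat.pow_le_pow_left (Nat.pow_le_pow_right hD hs) _
  · rw [Finset.card_univ, Fintype.card_fun, Fintype.card_fun, Fintype.card_coe,
      Fintype.card_subtype_compl, Fintype.card_coe, ← pow_add,
      Nat.sub_add_cancel (Finset.card_le_univ R)]

open scoped Classical in
theorem card_not_rigid_le {D : Finset F} (hD : 2 ≤ D.card) {h e : ℕ}
    (he : 2 * h + 2 * e ≤ Fintype.card m) :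
    ((Finset.univ.filter fun a : m → κ → D =>
        ¬ Rigid h (Matrix.of fun i j => (a i j : F))).card : ℝ) ≤
      ((D.card : ℝ) ^ Fintype.card m) ^ Fintype.card κ *
        ((16 ^ h * (17 / 16) ^ Fintype.card m) * ((1 + (1 / 2) ^ e) ^ Fintype.card κ *
          ((1 + (1 / 2) ^ e) ^ Fintype.card κ - 1))) := by
  set total := ((D.card : ℝ) ^ Fintype.card m) ^ Fintype.card κ
  let relations : Finset (Finset m × Finset κ × Finset κ) := Finset.univ.filter fun t =>
    t.1.card ≤ h ∧ t.2.2.card ≤ h ∧ t.2.1.card < t.2.2.card ∧ Disjoint t.2.1 t.2.2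
  let S : Finset m × Finset κ × Finset κ → Finset (m → κ → D) := fun t =>
    Finset.univ.filter fun a => ColumnsSpanned (Matrix.of fun i j => (a i j : F)) t.1 t.2.1 t.2.2
  have hbound : ∀ t ∈ relations, ((S t).card : ℝ) ≤ total * relationWeight h ((1 / 2) ^ e) t := by
    rintro ⟨W, J, R⟩ ht
    obtain ⟨hW, hR, hJR, hdisj⟩ : W.card ≤ h ∧ R.card ≤ h ∧ J.card < R.card ∧ Disjoint J R :=
      (Finset.mem_filter.1 ht).2
    have hcount : (S (W, J, R)).card * D.card ^ (2 * e * R.card) ≤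
        (D.card ^ Fintype.card m) ^ Fintype.card κ :=
      card_columnsSpanned_mul_le (by lia) W hdisj (by lia)
    replace hcount : ((S (W, J, R)).card : ℝ) * (D.card : ℝ) ^ (2 * e * R.card) ≤ total := by
      simp only [total]
      exact_mod_cast hcount
    have hweight := one_le_relationWeight_mul (d := D.card) (by exact_mod_cast hD) e hW hJR
    have hw := relationWeight_nonneg h (z := (1 / 2) ^ e) (by positivity) (W, J, R)
    calc ((S (W, J, R)).card : ℝ) ≤ (S (W, J, R)).card *
          (relationWeight h ((1 / 2) ^ e) (W, J, R) * (D.card : ℝ) ^ (2 * e * R.card)) :=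
          le_mul_of_one_le_right (Nat.cast_nonneg _) hweight
      _ = (S (W, J, R)).card * (D.card : ℝ) ^ (2 * e * R.card) *
          relationWeight h ((1 / 2) ^ e) (W, J, R) := by ring
      _ ≤ total * relationWeight h ((1 / 2) ^ e) (W, J, R) := by gcongr
  calc _ ≤ ((relations.biUnion S).card : ℝ) := by
        refine Nat.cast_le.2 (Finset.card_le_card fun a ha => ?_)
        obtain ⟨W, J, R, hW, hR, hJR, hdisj, hspan⟩ :=
          exists_columnsSpanned_of_not_rigid ((Finset.mem_filter_univ a).1 ha)
        exact Finset.mem_biUnion.2 ⟨(W, J, R), (Finset.mem_filter_univ _).2 ⟨hW, hR, hJR, hdisj⟩,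
          (Finset.mem_filter_univ a).2 hspan⟩
    _ ≤ ∑ t ∈ relations, ((S t).card : ℝ) := by exact_mod_cast Finset.card_biUnion_le
    _ ≤ ∑ t ∈ relations, total * relationWeight h ((1 / 2) ^ e) t := Finset.sum_le_sum hbound
    _ ≤ ∑ t, total * relationWeight h ((1 / 2) ^ e) t :=
        Finset.sum_le_sum_of_subset_of_nonneg (Finset.subset_univ _) fun t _ _ =>
          mul_nonneg (by positivity) (relationWeight_nonneg h (by positivity) t)
    _ = _ := by rw [← Finset.mul_sum, sum_relationWeight]

end RandomMatrices

theorem one_add_pow_le_one_add_two_mul {z : ℝ} (hz : 0 ≤ z) {n : ℕ} (hnz : n * z ≤ 1) :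
    (1 + z) ^ n ≤ 1 + 2 * (n * z) := by
  have hexp : (1 + z) ^ n ≤ Real.exp (n * z) := by
    rw [Real.exp_nat_mul]
    gcongr
    rw [add_comm]
    exact Real.add_one_le_exp z
  have hnz₀ : 0 ≤ n * z := by positivity
  have hquad := Real.abs_exp_sub_one_le (x := n * z) (by rwa [abs_of_nonneg hnz₀])
  rw [abs_of_nonneg hnz₀] at hquad
  linarith [(abs_le.1 hquad).2]

theorem pow_seventeen_div_sixteen_le {n m : ℕ} (hn : n ≤ 128 * m + 128) :
    (17 / 16 : ℝ) ^ n ≤ 2 ^ 16 * (2 ^ 16) ^ m := by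
  calc (17 / 16 : ℝ) ^ n ≤ (17 / 16) ^ (128 * m + 128) := pow_le_pow_right₀ (by norm_num) hn
    _ = ((17 / 16) ^ 8) ^ (16 * m + 16) := by rw [← pow_mul]; congr 1; ring
    _ ≤ 2 ^ (16 * m + 16) := by gcongr; norm_num
    _ = 2 ^ 16 * (2 ^ 16) ^ m := by rw [pow_add, pow_mul]; ring

theorem relationWeight_total_le {n m : ℕ} (hn : n ≤ 128 * m + 128)
    (hz : n * (1 / 256 : ℝ) ^ m ≤ 1) :
    (16 ^ (2 * m) * (17 / 16) ^ n) * ((1 + (1 / 2) ^ (32 * m)) ^ n *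
      ((1 + (1 / 2) ^ (32 * m)) ^ n - 1)) ≤ 6 * 2 ^ 16 * (n * (1 / 256 : ℝ) ^ m) := by
  obtain ⟨z, hz_eq⟩ : ∃ z : ℝ, z = (1 / 2) ^ (32 * m) := ⟨_, rfl⟩
  rw [← hz_eq]
  have hz₀ : 0 ≤ z := by rw [hz_eq]; positivity
  replace hz_eq : z = (1 / 256) ^ m * (1 / 2 ^ 24) ^ m := by
    rw [hz_eq, pow_mul, ← mul_pow]
    norm_num
  have hnz : n * z ≤ 1 := by
    refine le_trans ?_ hz
    rw [hz_eq]
    gcongr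
    exact mul_le_of_le_one_right (by positivity) (pow_le_one₀ (by norm_num) (by norm_num))
  have hpow := one_add_pow_le_one_add_two_mul hz₀ hnz
  have hone : 1 ≤ (1 + z) ^ n := one_le_pow₀ (by linarith)
  calc 16 ^ (2 * m) * (17 / 16) ^ n * ((1 + z) ^ n * ((1 + z) ^ n - 1))
      ≤ 16 ^ (2 * m) * (2 ^ 16 * (2 ^ 16) ^ m) * (3 * (2 * (n * z))) := by
        gcongr
        · exact pow_seventeen_div_sixteen_le hn
        · linarith
        · linarith
    _ = 6 * 2 ^ 16 * (n * (1 / 256) ^ m) * ((16 ^ 2) * 2 ^ 16 * (1 / 2 ^ 24)) ^ m := by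
        rw [hz_eq, mul_pow, mul_pow, pow_mul 16 2 m]
        ring
    _ = _ := by norm_num

theorem exists_pow_succ_mul_pow_div_le (C : ℕ) {b : ℝ} (hb : 0 < b) :
    ∃ n₀ : ℕ, ∀ n ≥ n₀, (n : ℝ) ^ (C + 1) * (1 / 256) ^ (n / 128) ≤ b := by
  have hlim := tendsto_pow_const_mul_const_pow_of_abs_lt_one (C + 1) (r := (1 / 256 : ℝ))
    (by rw [abs_of_pos] <;> norm_num)
  obtain ⟨m₀, hm₀⟩ := Filter.eventually_atTop.1
    (hlim.eventually_lt_const (u := b / 256 ^ (C + 1)) (by positivity))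
  refine ⟨128 * (m₀ + 1), fun n hn => ?_⟩
  have hlt := hm₀ (n / 128) (by lia)
  calc (n : ℝ) ^ (C + 1) * (1 / 256) ^ (n / 128)
      ≤ (256 * (n / 128 : ℕ)) ^ (C + 1) * (1 / 256) ^ (n / 128) := by
        gcongr
        exact_mod_cast (by lia : n ≤ 256 * (n / 128))
    _ = 256 ^ (C + 1) * ((n / 128 : ℕ) ^ (C + 1) * (1 / 256) ^ (n / 128)) := by
        rw [mul_pow]
        ring
    _ ≤ 256 ^ (C + 1) * (b / 256 ^ (C + 1)) := by gcongr
    _ = b := by field_simp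

open scoped Classical in
theorem exists_card_not_rigid_le (C : ℕ) : ∃ n₀ : ℕ, ∀ n ≥ n₀,
    ∀ (F : Type u) [Field F] (D : Finset F), 2 ≤ D.card →
      ((Finset.univ.filter fun a : Fin n → Fin n → D =>
        ¬ Rigid (2 * (n / 128)) (Matrix.of fun i j => (a i j : F))).card : ℝ) ≤
        (D.card : ℝ) ^ (n * n) / (8 * n ^ C) := by
  obtain ⟨n₁, hn₁⟩ := exists_pow_succ_mul_pow_div_le C (b := 1 / (8 * 6 * 2 ^ 16)) (by norm_num)
  refine ⟨n₁ + 1, fun n hn F _ D hD => ?_⟩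
  have hdecay := hn₁ n (by lia)
  have hn0 : (1 : ℝ) ≤ n := by exact_mod_cast (by lia : 1 ≤ n)
  have hz : n * (1 / 256 : ℝ) ^ (n / 128) ≤ 1 := by
    calc n * (1 / 256 : ℝ) ^ (n / 128) ≤ n ^ (C + 1) * (1 / 256 : ℝ) ^ (n / 128) := by
          gcongr
          exact le_self_pow₀ hn0 (Nat.succ_ne_zero C)
      _ ≤ 1 := hdecay.trans (by norm_num)
  have hcount := card_not_rigid_le (m := Fin n) (κ := Fin n) hD (h := 2 * (n / 128))
    (e := 32 * (n / 128)) (by rw [Fintype.card_fin]; lia)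
  rw [Fintype.card_fin, ← pow_mul] at hcount
  calc _ ≤ _ := hcount
    _ ≤ (D.card : ℝ) ^ (n * n) * (6 * 2 ^ 16 * (n * (1 / 256 : ℝ) ^ (n / 128))) := by
        exact mul_le_mul_of_nonneg_left (relationWeight_total_le (by lia) hz) (by positivity)
    _ ≤ (D.card : ℝ) ^ (n * n) * (1 / (8 * n ^ C)) := by
        gcongr
        rw [le_div_iff₀ (by positivity)]
        linear_combination (8 * 6 * 2 ^ 16) * hdecay
    _ = (D.card : ℝ) ^ (n * n) / (8 * n ^ C) := mul_one_div _ _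

namespace MatMul

variable {F : Type*} [Field F] {n : ℕ} {D : Finset F}

open scoped Classical in
theorem card_not_rigid_right_le {h : ℕ} :
    (Finset.univ.filter fun x : Idx n → D => ¬ Rigid h (right x)).card ≤
      D.card ^ (n * n) * (Finset.univ.filter fun a : Fin n → Fin n → D =>
        ¬ Rigid h (Matrix.of fun i j => (a i j : F))).card := by
  have hall : (Finset.univ : Finset (Fin n × Fin n → D)).card = D.card ^ (n * n) := by simp
  rw [← hall, ← Finset.card_product]
  refine Finset.card_le_card_of_injOn
    (fun x => (fun p => x (.inl p), fun i j => x (.inr (i, j)))) (fun x hx => ?_)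
    fun x _ y _ hxy => ?_
  · exact Finset.mem_product.2 ⟨Finset.mem_univ _,
      (Finset.mem_filter_univ _).2 ((Finset.mem_filter_univ x).1 hx)⟩
  · rw [Prod.mk.injEq] at hxy
    funext i
    rcases i with p | ⟨i, j⟩
    · exact congrFun hxy.1 p
    · exact congrFun (congrFun hxy.2 i) j

open scoped Classical in
theorem card_not_rigidPair_le {h : ℕ} :
    (Finset.univ.filter fun x : Idx n → D => ¬ RigidPair h x).card ≤
      2 * (D.card ^ (n * n) * (Finset.univ.filter fun a : Fin n → Fin n → D =>
        ¬ Rigid h (Matrix.of fun i j => (a i j : F))).card) := by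
  let S₁ := Finset.univ.filter fun x : Idx n → D => ¬ Rigid h (right x)
  let S₂ := Finset.univ.filter fun x : Idx n → D => ¬ Rigid h (left x).transpose
  have hflip : S₂.card ≤ S₁.card := Finset.card_le_card_of_injOn (· ∘ flip)
    (fun x hx => (Finset.mem_filter_univ _).2 ((Finset.mem_filter_univ x).1 hx))
    fun x _ x' _ heq => flip.surjective.injective_comp_right heq
  have hcover : (Finset.univ.filter fun x : Idx n → D => ¬ RigidPair h x) ⊆ S₁ ∪ S₂ :=
    fun x hx => by
      simpa [S₁, S₂, RigidPair, imp_iff_not_or] using hx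
  calc _ ≤ S₁.card + S₂.card := (Finset.card_le_card hcover).trans (Finset.card_union_le _ _)
    _ ≤ 2 * S₁.card := by lia
    _ ≤ _ := Nat.mul_le_mul_left 2 card_not_rigid_right_le

end MatMul

theorem card_mul_le_of_cylinders {ι δ : Type*} [Fintype ι] [DecidableEq ι] [Fintype δ]
    [DecidableEq δ] {Q : (ι → δ) → Finset ι} (hQ : ∀ x y, (∀ i ∈ Q x, y i = x i) → Q y = Q x)
    (S : Finset (ι → δ)) {r : ℕ} (hδ : 0 < Fintype.card δ)
    (hS : ∀ x₀ ∈ S, (S.filter fun x => ∀ i ∈ Q x₀, x i = x₀ i).card *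
      (r * Fintype.card δ ^ (Q x₀).card) ≤ Fintype.card δ ^ Fintype.card ι) :
    S.card * r ≤ Fintype.card δ ^ Fintype.card ι := by
  let seen : (ι → δ) → ι → Option δ := fun x i => if i ∈ Q x then some (x i) else none
  have hseen (x y : ι → δ) : seen y = seen x ↔ ∀ i ∈ Q x, y i = x i := by
    refine ⟨fun h i hi => ?_, fun h => funext fun i => ?_⟩
    · have hi' := congrFun h i
      simp only [seen, if_pos hi] at hi'
      split_ifs at hi'
      exact Option.some_injective _ hi'
    · simp only [seen, hQ x y h]
      split_ifs with hi
      exacts [congrArg some (h i hi), rfl]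
  have hcylinder (x₀ : ι → δ) (hx₀ : x₀ ∈ S) : (S.filter fun x => seen x = seen x₀).card * r ≤
      (Finset.univ.filter fun x => seen x = seen x₀).card := by
    simp only [hseen]
    refine Nat.le_of_mul_le_mul_right ?_ (Nat.pow_pos (n := (Q x₀).card) hδ)
    rw [mul_assoc, card_agree_mul]
    exact hS x₀ hx₀
  rw [← Fintype.card_fun, ← Finset.card_univ,
    Finset.card_eq_sum_card_fiberwise (s := S) (f := seen) (t := S.image seen)
      fun x hx => Finset.mem_coe.2 (Finset.mem_image_of_mem seen hx), Finset.sum_mul]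
  calc _ ≤ ∑ b ∈ S.image seen, (Finset.univ.filter fun x => seen x = b).card :=
        Finset.sum_le_sum fun b hb => by
          obtain ⟨x₀, hx₀, rfl⟩ := Finset.mem_image.1 hb
          exact hcylinder x₀ hx₀
    _ ≤ Finset.univ.card := by
        rw [Finset.sum_card_fiberwise_eq_card_filter]
        exact Finset.card_filter_le _ _

/-- A deterministic device that reads at most one input coordinate per step. The next state and the
statements output in a step depend only on the state and on the answer to the query, which is `none`
if nothing is queried. -/
structure QueryMachine (ι κ D R : Type*) where
  State : Type
  start : State
  query : State → Option ι
  next : State → Option D → State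
  emit : State → Option D → Set (κ × R)

namespace QueryMachine

variable {ι κ D R : Type*} (P : QueryMachine ι κ D R)

/-- The state after `t` steps from the state `v` on the input `x`. -/
def run (v : P.State) (x : ι → D) (t : ℕ) : P.State :=
  (fun u => P.next u ((P.query u).map x))^[t] v

/-- The statements output in step `t`. -/
def emittedAt (v : P.State) (x : ι → D) (t : ℕ) : Set (κ × R) :=
  P.emit (P.run v x t) ((P.query (P.run v x t)).map x)

/-- The statements output in the first `q` steps. -/
def emitted (v : P.State) (x : ι → D) (q : ℕ) : Set (κ × R) :=
  {e | ∃ t < q, e ∈ P.emittedAt v x t}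

theorem run_succ (v : P.State) (x : ι → D) (t : ℕ) :
    P.run v x (t + 1) = P.next (P.run v x t) ((P.query (P.run v x t)).map x) :=
  Function.iterate_succ_apply' _ t v

theorem run_add (v : P.State) (x : ι → D) (s t : ℕ) :
    P.run v x (s + t) = P.run (P.run v x s) x t := by
  unfold run
  rw [add_comm, Function.iterate_add_apply]

theorem emittedAt_run (v : P.State) (x : ι → D) (s t : ℕ) :
    P.emittedAt (P.run v x s) x t = P.emittedAt v x (s + t) := by
  rw [emittedAt, ← run_add, emittedAt]

theorem emitted_zero (v : P.State) (x : ι → D) : P.emitted v x 0 = ∅ :=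
  Set.eq_empty_of_forall_notMem fun _ ⟨t, ht, _⟩ => Nat.not_lt_zero t ht

theorem emitted_mono (v : P.State) (x : ι → D) {q q' : ℕ} (h : q ≤ q') :
    P.emitted v x q ⊆ P.emitted v x q' :=
  fun _ ⟨t, ht, he⟩ => ⟨t, ht.trans_le h, he⟩

theorem emitted_add_subset (v : P.State) (x : ι → D) (s q : ℕ) :
    P.emitted v x (s + q) ⊆ P.emitted v x s ∪ P.emitted (P.run v x s) x q := by
  rintro e ⟨t, ht, he⟩
  rcases lt_or_ge t s with hts | hst
  · exact .inl ⟨t, hts, he⟩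
  · exact .inr ⟨t - s, by lia, by rwa [emittedAt_run, Nat.add_sub_cancel' hst]⟩

section Queried

variable [DecidableEq ι]

/-- The coordinates queried in the first `q` steps. -/
def queried (v : P.State) (x : ι → D) (q : ℕ) : Finset ι :=
  (Finset.range q).biUnion fun t => (P.query (P.run v x t)).toFinset

theorem card_queried_le (v : P.State) (x : ι → D) (q : ℕ) : (P.queried v x q).card ≤ q := by
  refine (Finset.card_biUnion_le_card_mul _ _ 1 fun t _ => ?_).trans (by simp)
  cases P.query (P.run v x t) <;> simp

variable {P} {v : P.State} {x y : ι → D} {q : ℕ}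

theorem answer_congr (h : ∀ i ∈ P.queried v x q, y i = x i) {t : ℕ} (ht : t < q) :
    (P.query (P.run v x t)).map y = (P.query (P.run v x t)).map x :=
  Option.map_congr fun i hi => h i <|
    Finset.mem_biUnion.2 ⟨t, Finset.mem_range.2 ht, Option.mem_toFinset.2 hi⟩

theorem run_congr (h : ∀ i ∈ P.queried v x q, y i = x i) {t : ℕ} (ht : t ≤ q) :
    P.run v y t = P.run v x t := by
  induction t with
  | zero => rfl
  | succ t ih => rw [run_succ, run_succ, ih (Nat.le_of_lt ht), answer_congr h ht]

theorem queried_congr (h : ∀ i ∈ P.queried v x q, y i = x i) :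
    P.queried v y q = P.queried v x q :=
  Finset.biUnion_congr rfl fun t ht => by rw [run_congr h (Finset.mem_range.1 ht).le]

theorem emitted_congr (h : ∀ i ∈ P.queried v x q, y i = x i) :
    P.emitted v y q = P.emitted v x q :=
  Set.ext fun e => exists_congr fun t => and_congr_right fun ht => by
    rw [emittedAt, run_congr h ht.le, answer_congr h ht, emittedAt]

end Queried

/-- At most `K * 2 ^ y` states are allotted to each time `s` and each budget `y`. -/
def IsCheap (K : ℕ) (cheap : ℕ → ℝ → Finset P.State) : Prop :=
  ∀ s y, 0 ≤ y → ((cheap s y).card : ℝ) ≤ K * 2 ^ y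

/-- On the input `x` the machine outputs every entry of `f` before time `τ` and never a wrong
value, and at every time `s < τ` it is in one of the states allotted to the budget `cost s`. -/
structure ComputesWithCost (cheap : ℕ → ℝ → Finset P.State) (f : κ → R) (x : ι → D) (τ : ℕ)
    (cost : ℕ → ℝ) : Prop where
  cost_nonneg : ∀ t, 0 ≤ cost t
  cost_zero : cost 0 = 0
  mem_cheap : ∀ s < τ, ∀ y, cost s ≤ y → P.run P.start x s ∈ cheap s y
  correct : ∀ t, ∀ e ∈ P.emittedAt P.start x t, e.2 = f e.1
  complete : ∀ j, ∃ t < τ, ∃ o, (j, o) ∈ P.emittedAt P.start x t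

end QueryMachine

namespace MatMul

theorem card_input {F : Type*} {n : ℕ} {D : Finset F} :
    Fintype.card (Idx n → D) = D.card ^ (n * n) * D.card ^ (n * n) := by
  rw [Fintype.card_fun, Fintype.card_coe, Fintype.card_sum, Fintype.card_prod, Fintype.card_fin,
    pow_add]

variable {F : Type*} [Field F] {n : ℕ} {D : Finset F}

/-- From the state `v`, at least `k` entries are output within `q` steps, all of them correctly. -/
def Advances (P : QueryMachine (Idx n) (Fin n × Fin n) D F) (v : P.State) (q k : ℕ)
    (x : Idx n → D) : Prop :=
  (∀ e ∈ P.emitted v x q, e.2 = product x e.1) ∧ k ≤ (Prod.fst '' P.emitted v x q).ncard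

open scoped Classical in
theorem card_advances_mul_le (hD : 1 ≤ D.card) {h : ℕ} (hn : n ≤ 128 * h)
    (P : QueryMachine (Idx n) (Fin n × Fin n) D F) (v : P.State) {q k R : ℕ}
    (hq : q ^ 2 ≤ h ^ 2 * k) (hR : 1024 * R < k + 1024) :
    (Finset.univ.filter fun x : Idx n → D => RigidPair h x ∧ Advances P v q k x).card *
      D.card ^ R ≤ D.card ^ (n * n) * D.card ^ (n * n) := by
  have hX : D.card ^ (n * n) * D.card ^ (n * n) = Fintype.card D ^ Fintype.card (Idx n) := by
    rw [← card_input, Fintype.card_fun]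
  rw [hX]
  refine card_mul_le_of_cylinders (Q := fun x => P.queried v x q)
    (fun x y => QueryMachine.queried_congr) _ (by rwa [Fintype.card_coe]) fun x₀ hx₀ => ?_
  obtain ⟨-, hcorrect, hmany⟩ := (Finset.mem_filter_univ x₀).1 hx₀
  have hcount := card_correct_mul_le hD hn (P.queried v x₀ q) x₀
    (Prod.fst '' P.emitted v x₀ q).toFinset (product x₀) (by rwa [← Set.ncard_eq_toFinset_card'])
    ((Nat.pow_le_pow_left (P.card_queried_le v x₀ q) 2).trans hq) hR
  rw [← hX, Fintype.card_coe]
  refine (Nat.mul_le_mul_right _ (Finset.card_le_card fun x hx => ?_)).trans hcount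
  obtain ⟨hxS, hagree⟩ := Finset.mem_filter.1 hx
  obtain ⟨hrigid, hcorrect', -⟩ := (Finset.mem_filter_univ x).1 hxS
  refine (Finset.mem_filter_univ x).2 ⟨hagree, hrigid, fun p hp => ?_⟩
  obtain ⟨e, he, rfl⟩ := Set.mem_toFinset.1 hp
  rw [← hcorrect e he, ← hcorrect' e (by rwa [QueryMachine.emitted_congr hagree])]

open scoped Classical in
theorem card_advances_le (hD : 1 ≤ D.card) {h : ℕ} (hn : n ≤ 128 * h)
    (P : QueryMachine (Idx n) (Fin n × Fin n) D F) (v : P.State) {q k : ℕ}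
    (hq : q ^ 2 ≤ h ^ 2 * k) :
    ((Finset.univ.filter fun x : Idx n → D => RigidPair h x ∧ Advances P v q k x).card : ℝ) ≤
      Fintype.card (Idx n → D) * 2 ^ (-(k * Real.logb 2 D.card / 1024)) := by
  have hcount := card_advances_mul_le hD hn P v (R := (k + 1023) / 1024) hq (by lia)
  rw [← card_input] at hcount
  set R := (k + 1023) / 1024
  have hR : (k : ℝ) / 1024 ≤ R := by
    rw [div_le_iff₀ (by norm_num)]
    exact_mod_cast (by lia : k ≤ R * 1024)
  have hD' : (1 : ℝ) ≤ D.card := by exact_mod_cast hD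
  have hlog : 0 ≤ Real.logb 2 D.card := Real.logb_nonneg (by norm_num) hD'
  have hpow : (2 : ℝ) ^ (k * Real.logb 2 D.card / 1024) ≤ (D.card : ℝ) ^ R := by
    calc (2 : ℝ) ^ (k * Real.logb 2 D.card / 1024) ≤ 2 ^ (Real.logb 2 D.card * R) := by
          refine Real.rpow_le_rpow_of_exponent_le (by norm_num) ?_
          rw [mul_div_right_comm, mul_comm]
          gcongr
      _ = (D.card : ℝ) ^ R := by
          rw [Real.rpow_mul_natCast (by norm_num),
            Real.rpow_logb (by norm_num) (by norm_num) (by linarith)]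
  rw [Real.rpow_neg (by norm_num), ← div_eq_mul_inv, le_div_iff₀ (by positivity)]
  refine (mul_le_mul_of_nonneg_left hpow (Nat.cast_nonneg _)).trans ?_
  exact_mod_cast hcount

open scoped Classical in
theorem sum_card_advances_le (hD : 1 ≤ D.card) {h : ℕ} (hn : n ≤ 128 * h)
    {P : QueryMachine (Idx n) (Fin n × Fin n) D F} {q k K : ℕ} (hq : q ^ 2 ≤ h ^ 2 * k)
    {V : Finset P.State} {y : ℝ} (hV : (V.card : ℝ) ≤ K * 2 ^ y)
    (hy : 2 * y ≤ k * Real.logb 2 D.card / 1024) :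
    ∑ v ∈ V, ((Finset.univ.filter fun x : Idx n → D =>
      RigidPair h x ∧ Advances P v q k x).card : ℝ) ≤
      Fintype.card (Idx n → D) * (K * (2 : ℝ) ^ (-y)) := by
  set X := Fintype.card (Idx n → D)
  calc _ ≤ (V.card : ℝ) * (X * (2 : ℝ) ^ (-(2 * y))) := by
        rw [← nsmul_eq_mul]
        refine Finset.sum_le_card_nsmul _ _ _ fun v _ => (card_advances_le hD hn P v hq).trans ?_
        gcongr
        norm_num
    _ ≤ (K * (2 : ℝ) ^ y) * (X * (2 : ℝ) ^ (-(2 * y))) := by gcongr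
    _ = X * (K * (2 : ℝ) ^ (-y)) := by
        rw [show -y = y + -(2 * y) by ring, Real.rpow_add (by norm_num)]
        ring

/-- Within the time allowed for a block of one of the kinds `i < n` started before time `T`, the
machine outputs an excessive number of entries, and it does so from a state that is cheap for that
kind of block. -/
def AdvancesCheaply (P : QueryMachine (Idx n) (Fin n × Fin n) D F) (cheap : ℕ → ℝ → Finset P.State)
    (T κ : ℕ) (q : ℕ → ℕ) (Λ : ℝ) (x : Idx n → D) : Prop :=
  ∃ s < T, ∃ i < n, ∃ v ∈ cheap s (4 ^ i * Λ), Advances P v (q i) (κ * 4 ^ i) x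

open scoped Classical in
theorem card_advancesCheaply_le (hD : 1 ≤ D.card) {h : ℕ} (hn : n ≤ 128 * h)
    {P : QueryMachine (Idx n) (Fin n × Fin n) D F} {cheap : ℕ → ℝ → Finset P.State} {K : ℕ}
    (hcheap : P.IsCheap K cheap) (T : ℕ) {κ : ℕ} {q : ℕ → ℕ}
    (hq : ∀ i, q i ^ 2 ≤ h ^ 2 * (κ * 4 ^ i)) {Λ : ℝ} (hΛ : Λ = κ * Real.logb 2 D.card / 2048) :
    ((Finset.univ.filter fun x : Idx n → D =>
      RigidPair h x ∧ AdvancesCheaply P cheap T κ q Λ x).card : ℝ) ≤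
      Fintype.card (Idx n → D) * (T * n * (K * 2 ^ (-Λ))) := by
  set X := Fintype.card (Idx n → D)
  have hlog : 0 ≤ Real.logb 2 D.card := Real.logb_nonneg (by norm_num) (by exact_mod_cast hD)
  have hΛ₀ : 0 ≤ Λ := by rw [hΛ]; positivity
  let S (i : ℕ) (v : P.State) : Finset (Idx n → D) :=
    Finset.univ.filter fun x => RigidPair h x ∧ Advances P v (q i) (κ * 4 ^ i) x
  have hkind (s i : ℕ) : ∑ v ∈ cheap s (4 ^ i * Λ), ((S i v).card : ℝ) ≤
      X * (K * (2 : ℝ) ^ (-Λ)) := by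
    refine (sum_card_advances_le hD hn (hq i) (hcheap s _ (by positivity)) ?_).trans ?_
    · rw [hΛ]
      push_cast
      exact le_of_eq (by ring)
    · gcongr
      · norm_num
      · exact le_mul_of_one_le_left hΛ₀ (one_le_pow₀ (by norm_num))
  let bad := (Finset.range T).biUnion fun s => (Finset.range n).biUnion fun i =>
    (cheap s (4 ^ i * Λ)).biUnion (S i)
  have hunion : bad.card ≤ ∑ s ∈ Finset.range T, ∑ i ∈ Finset.range n,
      ∑ v ∈ cheap s (4 ^ i * Λ), (S i v).card :=
    Finset.card_biUnion_le.trans <| Finset.sum_le_sum fun s _ =>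
      Finset.card_biUnion_le.trans <| Finset.sum_le_sum fun i _ => Finset.card_biUnion_le
  calc _ ≤ (bad.card : ℝ) := by
        refine Nat.cast_le.2 (Finset.card_le_card fun x hx => ?_)
        obtain ⟨hrigid, s, hs, i, hi, v, hv, hadv⟩ := (Finset.mem_filter_univ x).1 hx
        simp only [bad, Finset.mem_biUnion, Finset.mem_range]
        exact ⟨s, hs, i, hi, v, hv, (Finset.mem_filter_univ x).2 ⟨hrigid, hadv⟩⟩
    _ ≤ ∑ s ∈ Finset.range T, ∑ i ∈ Finset.range n,
          ∑ v ∈ cheap s (4 ^ i * Λ), ((S i v).card : ℝ) := by exact_mod_cast hunion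
    _ ≤ ∑ _s ∈ Finset.range T, ∑ _i ∈ Finset.range n, (X : ℝ) * (K * (2 : ℝ) ^ (-Λ)) :=
        Finset.sum_le_sum fun _ _ => Finset.sum_le_sum fun _ _ => hkind _ _
    _ = X * (T * n * (K * (2 : ℝ) ^ (-Λ))) := by
        simp only [Finset.sum_const, Finset.card_range, nsmul_eq_mul]
        ring

end MatMul

/-- The time interval `[0, e)` is divided into blocks. The `m` base blocks have length at most
`2 * w` and bring fewer than `κ` outputs each. Every `i` in `L` stands for a block of length between
`2 ^ i * w` and `2 ^ (i + 1) * w`, which brings fewer than `κ * 4 ^ i` outputs at a cost of order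
`8 ^ i`. Here `N` counts outputs and `g` is the cost at a given time. -/
structure IsBlockDecomposition (g : ℕ → ℝ) (Λ : ℝ) (w κ : ℕ) (N : ℕ → ℕ) (e m : ℕ) (L : List ℕ) :
    Prop where
  output_le : (N e : ℝ) ≤ m * (κ - 1) + κ * (L.map fun i => (4 : ℝ) ^ i).sum
  base_length_le : m * w ≤ e + w
  length_le : (L.map fun i => (2 : ℝ) ^ i).sum * w ≤ e
  cost_le : w * Λ * (L.map fun i => (8 : ℝ) ^ i).sum ≤ 8 * ∑ t ∈ Finset.range e, g t

namespace IsBlockDecomposition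

variable {g : ℕ → ℝ} {Λ : ℝ} {w κ : ℕ} {N : ℕ → ℕ} {s e m : ℕ} {L : List ℕ}

theorem zero (hN : N 0 = 0) : IsBlockDecomposition g Λ w κ N 0 0 [] where
  output_le := by simp [hN]
  base_length_le := by simp
  length_le := by simp
  cost_le := by simp

theorem single_base (hg : ∀ t, 0 ≤ g t) (hN₀ : N 0 = 0) (hN : N e + 1 ≤ N 0 + κ) :
    IsBlockDecomposition g Λ w κ N e 1 [] where
  output_le := by
    have : (N e : ℝ) + 1 ≤ κ := by exact_mod_cast (by lia : N e + 1 ≤ κ)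
    simpa using by linarith
  base_length_le := by lia
  length_le := by simp
  cost_le := by simpa using Finset.sum_nonneg fun t _ => hg t

theorem add_base (h : IsBlockDecomposition g Λ w κ N s m L) (hg : ∀ t, 0 ≤ g t) (hs : s + w ≤ e)
    (hN : N e + 1 ≤ N s + κ) : IsBlockDecomposition g Λ w κ N e (m + 1) L where
  output_le := by
    have : (N e : ℝ) + 1 ≤ N s + κ := by exact_mod_cast hN
    push_cast
    linarith [h.output_le]
  base_length_le := by linarith [h.base_length_le]
  length_le := h.length_le.trans (by exact_mod_cast (by lia : s ≤ e))
  cost_le := h.cost_le.trans <| by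
    gcongr
    · exact fun t _ _ => hg t
    · lia

theorem add_long (h : IsBlockDecomposition g Λ w κ N s m L) {i : ℕ} (hs : s + 2 ^ i * w ≤ e)
    (hN : N e + 1 ≤ N s + κ * 4 ^ i)
    (hcost : w * Λ * 8 ^ i ≤ 8 * ∑ t ∈ Finset.Ico s e, g t) :
    IsBlockDecomposition g Λ w κ N e m (i :: L) where
  output_le := by
    have : (N e : ℝ) + 1 ≤ N s + κ * 4 ^ i := by exact_mod_cast hN
    rw [List.map_cons, List.sum_cons]
    linarith [h.output_le]
  base_length_le := by linarith [h.base_length_le, Nat.zero_le (2 ^ i * w)]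
  length_le := by
    have : (s : ℝ) + 2 ^ i * w ≤ e := by exact_mod_cast hs
    rw [List.map_cons, List.sum_cons]
    linarith [h.length_le]
  cost_le := by
    rw [← Finset.sum_range_add_sum_Ico g (le_of_add_le_left hs), List.map_cons, List.sum_cons]
    linarith [h.cost_le]

end IsBlockDecomposition

-- The last block is chosen of the smallest possible kind `i`: at distances from `e` that are
-- suited to a smaller kind, the cost must therefore be large.
theorem exists_last_block {g : ℕ → ℝ} {Λ : ℝ} {w e : ℕ} (hΛ : 0 ≤ Λ) (hg : g 0 ≤ Λ) (hw : 1 ≤ w)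
    (he : w < e) : ∃ i s, s + 2 ^ i * w < e ∧ e ≤ s + 2 ^ (i + 1) * w ∧ g s ≤ 4 ^ i * Λ ∧
      ∀ j < i, ∀ t, t + 2 ^ j * w < e → e ≤ t + 2 ^ (j + 1) * w → 4 ^ j * Λ ≤ g t := by
  classical
  have hlong : ∃ i, e ≤ 2 ^ (i + 1) * w :=
    ⟨e, by nlinarith [(Nat.lt_succ_self e).trans (Nat.lt_two_pow_self (n := e + 1))]⟩
  have hblock : ∃ i s, s + 2 ^ i * w < e ∧ e ≤ s + 2 ^ (i + 1) * w ∧ g s ≤ 4 ^ i * Λ := by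
    refine ⟨Nat.find hlong, 0, ?_, by simpa using Nat.find_spec hlong,
      hg.trans (le_mul_of_one_le_left hΛ (one_le_pow₀ (by norm_num)))⟩
    rcases h : Nat.find hlong with _ | j
    · simpa using he
    · have := Nat.find_min hlong (m := j) (by lia)
      lia
  obtain ⟨s, hs, hes, hgs⟩ := Nat.find_spec hblock
  refine ⟨_, s, hs, hes, hgs, fun j hj t ht het => ?_⟩
  by_contra! hlt
  exact Nat.find_min hblock hj ⟨t, ht, het, hlt.le⟩

theorem mul_eight_pow_le_sum {g : ℕ → ℝ} (hg : ∀ t, 0 ≤ g t) {Λ : ℝ} {w s e j : ℕ}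
    (hs : s + 2 ^ (j + 1) * w ≤ e)
    (hlow : ∀ t, t + 2 ^ j * w < e → e ≤ t + 2 ^ (j + 1) * w → 4 ^ j * Λ ≤ g t) :
    w * Λ * 8 ^ (j + 1) ≤ 8 * ∑ t ∈ Finset.Ico s e, g t := by
  have hpow : 2 ^ (j + 1) * w = 2 ^ j * w + 2 ^ j * w := by ring
  have hsum := Finset.card_nsmul_le_sum (Finset.Ico (e - 2 ^ (j + 1) * w) (e - 2 ^ j * w)) g
    (4 ^ j * Λ) fun t ht => hlow t (by grind) (by grind)
  rw [Nat.card_Ico, show e - 2 ^ j * w - (e - 2 ^ (j + 1) * w) = 2 ^ j * w by lia,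
    nsmul_eq_mul] at hsum
  calc w * Λ * 8 ^ (j + 1) = 8 * ((2 ^ j * w : ℕ) * (4 ^ j * Λ)) := by
        rw [pow_succ, show (8 : ℝ) = 2 * 4 by norm_num, mul_pow]
        push_cast
        ring
    _ ≤ 8 * ∑ t ∈ Finset.Ico (e - 2 ^ (j + 1) * w) (e - 2 ^ j * w), g t :=
        mul_le_mul_of_nonneg_left hsum (by norm_num)
    _ ≤ 8 * ∑ t ∈ Finset.Ico s e, g t := by
        gcongr
        · exact fun t _ _ => hg t
        · lia
        · lia

section Blocks

variable {g : ℕ → ℝ} {Λ : ℝ} {w κ τ : ℕ} {N : ℕ → ℕ}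

theorem exists_isBlockDecomposition (hg : ∀ t, 0 ≤ g t) (hΛ : 0 ≤ Λ) (hg₀ : g 0 ≤ Λ) (hw : 1 ≤ w)
    (hN₀ : N 0 = 0)
    (hN : ∀ s e i, s < e → e ≤ τ → e ≤ s + 2 ^ (i + 1) * w → g s ≤ 4 ^ i * Λ →
      N e + 1 ≤ N s + κ * 4 ^ i) :
    ∀ e ≤ τ, ∃ m L, IsBlockDecomposition g Λ w κ N e m L := by
  intro e
  induction e using Nat.strong_induction_on with
  | _ e ih =>
    intro he
    rcases Nat.eq_zero_or_pos e with rfl | hpos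
    · exact ⟨0, [], .zero hN₀⟩
    rcases le_or_gt e w with hew | hwe
    · exact ⟨1, [], .single_base hg hN₀ (by simpa using hN 0 e 0 hpos he (by lia) (by simpa))⟩
    obtain ⟨i, s, hs, hes, hgs, hlow⟩ := exists_last_block hΛ hg₀ hw hwe
    have hse : s < e := by lia
    obtain ⟨m, L, hL⟩ := ih s hse (by lia)
    have hblock := hN s e i hse he hes hgs
    rcases i with _ | j
    · exact ⟨m + 1, L, hL.add_base hg (by lia) (by simpa using hblock)⟩
    · exact ⟨m, (j + 1) :: L, hL.add_long hs.le hblock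
        (mul_eight_pow_le_sum hg hs.le (hlow j j.lt_succ_self))⟩

theorem sq_sum_four_pow_le (L : List ℕ) : (L.map fun i => (4 : ℝ) ^ i).sum ^ 2 ≤
    (L.map fun i => (2 : ℝ) ^ i).sum * (L.map fun i => (8 : ℝ) ^ i).sum := by
  simp only [← Fin.sum_univ_fun_getElem]
  refine Finset.sum_sq_le_sum_mul_sum_of_sq_le_mul _ (fun _ _ => by positivity)
    (fun _ _ => by positivity) fun i _ => ?_
  refine le_of_eq ?_
  rw [← mul_pow, ← pow_mul, mul_comm, pow_mul]
  norm_num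

theorem sq_mul_le_sum_of_block_bound (hg : ∀ t, 0 ≤ g t) (hΛ : 0 ≤ Λ) (hg₀ : g 0 ≤ Λ) (hw : 1 ≤ w)
    (hκ : 1 ≤ κ) (hN₀ : N 0 = 0)
    (hN : ∀ s e i, s < e → e ≤ τ → e ≤ s + 2 ^ (i + 1) * w → g s ≤ 4 ^ i * Λ →
      N e + 1 ≤ N s + κ * 4 ^ i)
    (hbase : (τ + w) * ((κ : ℝ) - 1) ≤ w * N τ / 2) :
    (N τ : ℝ) ^ 2 * w ^ 2 * Λ ≤ 32 * κ ^ 2 * (τ * ∑ t ∈ Finset.range τ, g t) := by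
  obtain ⟨m, L, hL⟩ := exists_isBlockDecomposition hg hΛ hg₀ hw hN₀ hN τ le_rfl
  set A := (L.map fun i => (2 : ℝ) ^ i).sum
  set B := (L.map fun i => (4 : ℝ) ^ i).sum
  set C := (L.map fun i => (8 : ℝ) ^ i).sum
  have hC : 0 ≤ C := List.sum_nonneg (by simp)
  have hκ' : (1 : ℝ) ≤ κ := by exact_mod_cast hκ
  have hm : (m : ℝ) * w ≤ τ + w := by exact_mod_cast hL.base_length_le
  have hshort : (m : ℝ) * (κ - 1) ≤ N τ / 2 := by
    refine le_of_mul_le_mul_left (a := (w : ℝ)) ?_ (by exact_mod_cast hw)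
    nlinarith [mul_le_mul_of_nonneg_right hm (sub_nonneg.2 hκ')]
  have hlong : (N τ : ℝ) ≤ 2 * (κ * B) := by linarith [hL.output_le]
  calc (N τ : ℝ) ^ 2 * w ^ 2 * Λ ≤ (2 * (κ * B)) ^ 2 * w ^ 2 * Λ := by gcongr
    _ = 4 * κ ^ 2 * w ^ 2 * Λ * B ^ 2 := by ring
    _ ≤ 4 * κ ^ 2 * w ^ 2 * Λ * (A * C) := by
        gcongr
        exact sq_sum_four_pow_le L
    _ = 4 * κ ^ 2 * ((A * w) * (w * Λ * C)) := by ring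
    _ ≤ 4 * κ ^ 2 * (τ * (8 * ∑ t ∈ Finset.range τ, g t)) := by
        exact mul_le_mul_of_nonneg_left
          (mul_le_mul hL.length_le hL.cost_le (by positivity) (by positivity)) (by positivity)
    _ = 32 * κ ^ 2 * (τ * ∑ t ∈ Finset.range τ, g t) := by ring

end Blocks

theorem two_rpow_neg_le {n E : ℕ} {l κ : ℝ} (hn : 0 < n) (hl : 0 < l) (hκ : 1 ≤ κ)
    (h : 4096 * E * Real.logb 2 n ≤ κ * l) :
    (2 : ℝ) ^ (-(κ * l / 2048)) ≤ 1 / n ^ E * (8192 / l) := by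
  have hlarge : l / 8192 ≤ (2 : ℝ) ^ (l / 4096) := by
    rw [Real.rpow_def_of_pos (by norm_num)]
    nlinarith [Real.add_one_le_exp (Real.log 2 * (l / 4096)), Real.log_two_gt_d9]
  have hn' : (0 : ℝ) < n := by exact_mod_cast hn
  calc (2 : ℝ) ^ (-(κ * l / 2048)) ≤ 2 ^ (-(Real.logb 2 n * E) + -(l / 4096)) := by
        refine Real.rpow_le_rpow_of_exponent_le (by norm_num) ?_
        linarith [le_mul_of_one_le_left hl.le hκ]
    _ = ((n : ℝ) ^ E)⁻¹ * ((2 : ℝ) ^ (l / 4096))⁻¹ := by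
        rw [Real.rpow_add (by norm_num), Real.rpow_neg (by norm_num), Real.rpow_neg (by norm_num),
          Real.rpow_mul_natCast (by norm_num), Real.rpow_logb (by norm_num) (by norm_num) hn']
    _ ≤ 1 / n ^ E * (8192 / l) := by
        rw [one_div]
        gcongr
        rw [← inv_div l]
        gcongr

theorem mul_two_rpow_neg_le {C K n T : ℕ} {l κ : ℝ} (hl : 1 ≤ l) (hlg : 1 ≤ Real.logb 2 n)
    (hκ : 1 ≤ κ) (hκl : 4096 * (C + 6 : ℕ) * Real.logb 2 n ≤ κ * l) (hn : 32768 * K + 2 ≤ n)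
    (hT : (T : ℝ) ≤ n ^ 3 * √(l / Real.logb 2 n)) :
    T * n * (K * (2 : ℝ) ^ (-(κ * l / 2048))) ≤ 1 / (4 * n ^ C) := by
  have hn₀ : (0 : ℝ) < n := by exact_mod_cast (by lia : 0 < n)
  have hT' : (T : ℝ) ≤ n ^ 3 * l := by
    refine hT.trans ?_
    gcongr
    rw [Real.sqrt_le_left (by linarith)]
    exact (div_le_self (by linarith) hlg).trans (by nlinarith)
  have hKn : 4 * (8192 * (K : ℝ)) ≤ n ^ 2 := by
    exact_mod_cast (by nlinarith : 4 * (8192 * K) ≤ n ^ 2)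
  calc (T : ℝ) * n * (K * (2 : ℝ) ^ (-(κ * l / 2048)))
      ≤ (n ^ 3 * l) * n * (K * (1 / n ^ (C + 6) * (8192 / l))) := by
        gcongr
        exact two_rpow_neg_le (by lia) (by linarith) hκ hκl
    _ = (8192 * K / n ^ 2) * (1 / n ^ C) := by
        have : l ≠ 0 := by linarith
        field_simp
        ring
    _ ≤ 1 / 4 * (1 / n ^ C) := by
        refine mul_le_mul_of_nonneg_right ?_ (by positivity)
        rw [div_le_div_iff₀ (by positivity) (by norm_num)]
        linarith
    _ = 1 / (4 * n ^ C) := by rw [one_div_mul_one_div]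

-- `r = ⌈√(A * b / l)⌉`
theorem exists_block_scale {n l b A : ℝ} (hl : 1 ≤ l) (hb : 1 ≤ b) (hbn : b ≤ n) (hA : 1 ≤ A)
    (hAn : 16 * A ≤ n) : ∃ r : ℕ, 1 ≤ r ∧ A * b ≤ r ^ 2 * l ∧ (r : ℝ) ^ 2 - 1 ≤ n * n / 4 ∧
      √(l / b) * (r ^ 2 - 1) ≤ 2 * A * r := by
  set ρ := √(A * b / l) with hρ
  have hρ₀ : 0 < ρ := Real.sqrt_pos.2 (by positivity)
  have hρ₂ : ρ ^ 2 = A * b / l := Real.sq_sqrt (by positivity)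
  have hr : 1 ≤ ⌈ρ⌉₊ := Nat.one_le_ceil_iff.2 hρ₀
  have hr' : (1 : ℝ) ≤ ⌈ρ⌉₊ := by exact_mod_cast hr
  have hle := Nat.le_ceil ρ
  have hlt := Nat.ceil_lt_add_one hρ₀.le
  refine ⟨⌈ρ⌉₊, hr, ?_, ?_, ?_⟩
  · rw [← div_le_iff₀ (by linarith), ← hρ₂]
    gcongr
  · have : ρ ^ 2 ≤ A * n := by
      rw [hρ₂]
      exact (div_le_self (by positivity) hl).trans (by gcongr)
    nlinarith [sq_nonneg (ρ - 1)]
  · have hdiff : (⌈ρ⌉₊ : ℝ) ^ 2 - 1 ≤ ρ * (2 * ⌈ρ⌉₊) := by nlinarith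
    have hprod : √(l / b) * ρ ≤ A := by
      rw [hρ, ← Real.sqrt_mul (by positivity),
        show l / b * (A * b / l) = A by field_simp, Real.sqrt_le_left (by positivity)]
      nlinarith
    calc √(l / b) * (⌈ρ⌉₊ ^ 2 - 1) ≤ √(l / b) * (ρ * (2 * ⌈ρ⌉₊)) := by gcongr
      _ = √(l / b) * ρ * (2 * ⌈ρ⌉₊) := by ring
      _ ≤ A * (2 * ⌈ρ⌉₊) := by gcongr
      _ = 2 * A * ⌈ρ⌉₊ := by ring

theorem base_output_le {n l b A ε r m τ : ℝ} (hn : 0 ≤ n) (hε : 0 ≤ ε) (hεA : 2048 * (ε * A) ≤ 1)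
    (hr : 1 ≤ r) (hrn : r ^ 2 - 1 ≤ n * n / 4) (hrA : √(l / b) * (r ^ 2 - 1) ≤ 2 * A * r)
    (hm : n / 256 ≤ m) (hτ : τ ≤ ε * (n ^ 3 * √(l / b))) :
    (τ + m * r) * (r ^ 2 - 1) ≤ m * r * (n * n) / 2 := by
  have hr₀ : 0 ≤ r ^ 2 - 1 := by nlinarith
  have hm₀ : 0 ≤ m := le_trans (by positivity) hm
  have htime : τ * (r ^ 2 - 1) ≤ m * r * (n * n) / 4 := by
    calc τ * (r ^ 2 - 1) ≤ ε * (n ^ 3 * √(l / b)) * (r ^ 2 - 1) := by gcongr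
      _ = ε * n ^ 3 * (√(l / b) * (r ^ 2 - 1)) := by ring
      _ ≤ ε * n ^ 3 * (2 * A * r) := by gcongr
      _ = 2048 * (ε * A) * (n / 256 * r * (n * n) / 4) := by ring
      _ ≤ 1 * (n / 256 * r * (n * n) / 4) := by gcongr
      _ ≤ m * r * (n * n) / 4 := by
          rw [one_mul]
          gcongr
  have hlast : m * r * (r ^ 2 - 1) ≤ m * r * (n * n / 4) := by gcongr
  linarith

theorem mul_pow_six_le {n l r m ε y : ℝ} (hn : 0 ≤ n) (hl : 0 ≤ l) (hr : 0 < r)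
    (hε : ε ≤ 1 / 2 ^ 32) (hm : n / 256 ≤ m)
    (h : (n * n) ^ 2 * (m * r) ^ 2 * (r ^ 2 * l / 2048) ≤ 32 * (r ^ 2) ^ 2 * y) :
    ε * (n ^ 6 * l) ≤ y := by
  have hcancel : r ^ 4 * (n ^ 4 * m ^ 2 * l / 65536) ≤ r ^ 4 * y := by
    calc r ^ 4 * (n ^ 4 * m ^ 2 * l / 65536)
        = (n * n) ^ 2 * (m * r) ^ 2 * (r ^ 2 * l / 2048) / 32 := by ring
      _ ≤ r ^ 4 * y := by linarith
  calc ε * (n ^ 6 * l) ≤ (1 / 2 ^ 32) * (n ^ 6 * l) := by gcongr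
    _ = n ^ 4 * (n / 256) ^ 2 * l / 65536 := by ring
    _ ≤ n ^ 4 * m ^ 2 * l / 65536 := by gcongr
    _ ≤ y := le_of_mul_le_mul_left hcancel (by positivity)

theorem one_le_logb_two {n : ℕ} (hn : 2 ≤ n) : 1 ≤ Real.logb 2 n := by
  rw [Real.le_logb_iff_rpow_le (by norm_num) (by positivity)]
  simpa using hn

theorem logb_two_natCast_le_self (n : ℕ) : Real.logb 2 n ≤ n := by
  rcases n.eq_zero_or_pos with rfl | hn
  · simp
  · rw [Real.logb_le_iff_le_rpow (by norm_num) (Nat.cast_pos.2 hn), Real.rpow_natCast]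
    exact_mod_cast Nat.lt_two_pow_self.le

namespace MatMul

variable {F : Type*} [Field F] {n : ℕ} {D : Finset F}
  {P : QueryMachine (Idx n) (Fin n × Fin n) D F} {cheap : ℕ → ℝ → Finset P.State} {T κ : ℕ} {Λ : ℝ}

open scoped Classical in
theorem exists_mem_not_advancesCheaply (hD : 1 ≤ D.card) {h : ℕ} (hn : n ≤ 128 * h) (hn₀ : 0 < n)
    {K : ℕ} (hcheap : P.IsCheap K cheap) {q : ℕ → ℕ} (hq : ∀ i, q i ^ 2 ≤ h ^ 2 * (κ * 4 ^ i))
    (hΛ : Λ = κ * Real.logb 2 D.card / 2048) {C : ℕ}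
    (hrigid : ((Finset.univ.filter fun a : Fin n → Fin n → D =>
      ¬ Rigid h (Matrix.of fun i j => (a i j : F))).card : ℝ) ≤
      (D.card : ℝ) ^ (n * n) / (8 * n ^ C))
    (hT : T * n * (K * (2 : ℝ) ^ (-Λ)) ≤ 1 / (4 * n ^ C)) {G : Set (Idx n → D)}
    (hG : (Fintype.card (Idx n → D) : ℝ) / n ^ C ≤ Nat.card G) :
    ∃ x ∈ G, ¬ AdvancesCheaply P cheap T κ q Λ x := by
  set X := Fintype.card (Idx n → D) with hX
  by_contra! hadv
  have hcover : Nat.card G ≤ (Finset.univ.filter fun x : Idx n → D => ¬ RigidPair h x).card +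
      (Finset.univ.filter fun x : Idx n → D =>
        RigidPair h x ∧ AdvancesCheaply P cheap T κ q Λ x).card := by
    rw [Nat.card_coe_set_eq, Set.ncard_eq_toFinset_card']
    refine (Finset.card_le_card fun x hx => ?_).trans (Finset.card_union_le _ _)
    rw [Finset.mem_union, Finset.mem_filter_univ, Finset.mem_filter_univ]
    exact (em (RigidPair h x)).symm.imp_right fun hx' => ⟨hx', hadv x (Set.mem_toFinset.1 hx)⟩
  have hX₀ : (0 : ℝ) < X / n ^ C := by
    rw [hX, card_input]
    positivity
  have hnonrigid : ((Finset.univ.filter fun x : Idx n → D => ¬ RigidPair h x).card : ℝ) ≤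
      X / n ^ C / 4 := by
    calc _ ≤ 2 * ((D.card : ℝ) ^ (n * n) * ((D.card : ℝ) ^ (n * n) / (8 * n ^ C))) := by
          refine le_trans (Nat.cast_le.2 card_not_rigidPair_le) ?_
          push_cast
          gcongr
      _ = X / n ^ C / 4 := by
          rw [hX, card_input]
          push_cast
          ring
  have hcheaply : ((Finset.univ.filter fun x : Idx n → D =>
      RigidPair h x ∧ AdvancesCheaply P cheap T κ q Λ x).card : ℝ) ≤ X / n ^ C / 4 := by
    calc _ ≤ X * (T * n * (K * (2 : ℝ) ^ (-Λ))) := card_advancesCheaply_le hD hn hcheap T hq hΛ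
      _ ≤ X * (1 / (4 * n ^ C)) := by gcongr
      _ = X / n ^ C / 4 := by ring
  have hcover' := Nat.cast_le (α := ℝ).2 hcover
  push_cast at hcover'
  linarith

variable {x : Idx n → D} {τ w : ℕ} {g : ℕ → ℝ}

theorem ncard_emitted_lt (hP : P.ComputesWithCost cheap (product x) x τ g) (hτ : τ ≤ T)
    (hκ : 1 ≤ κ) {q : ℕ → ℕ} (hadv : ¬ AdvancesCheaply P cheap T κ q Λ x) {s i : ℕ} (hs : s < τ)
    (hgs : g s ≤ 4 ^ i * Λ) :
    (Prod.fst '' P.emitted (P.run P.start x s) x (q i)).ncard < κ * 4 ^ i := by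
  by_contra! hmany
  rcases lt_or_ge i n with hi | hi
  · refine hadv ⟨s, hs.trans_le hτ, i, hi, _, hP.mem_cheap s hs _ hgs, ?_, hmany⟩
    rintro e ⟨t, -, he⟩
    exact hP.correct _ e (by rwa [QueryMachine.emittedAt_run] at he)
  · have hle : (Prod.fst '' P.emitted (P.run P.start x s) x (q i)).ncard ≤ n * n := by
      simpa using Set.ncard_le_card (Prod.fst '' P.emitted (P.run P.start x s) x (q i))
    have hlt : n * n < 4 ^ i := by
      calc n * n < 2 ^ n * 2 ^ n := Nat.mul_lt_mul'' Nat.lt_two_pow_self Nat.lt_two_pow_self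
        _ = 4 ^ n := by rw [← mul_pow]; norm_num
        _ ≤ 4 ^ i := Nat.pow_le_pow_right (by norm_num) hi
    linarith [Nat.le_mul_of_pos_left (4 ^ i) hκ]

theorem sq_mul_le_sum_cost (hP : P.ComputesWithCost cheap (product x) x τ g) (hτ : τ ≤ T)
    (hκ : 1 ≤ κ) (hadv : ¬ AdvancesCheaply P cheap T κ (fun i => 2 ^ (i + 1) * w) Λ x) (hΛ : 0 ≤ Λ)
    (hw : 1 ≤ w) (hbase : (τ + w) * ((κ : ℝ) - 1) ≤ w * (n * n) / 2) :
    ((n : ℝ) * n) ^ 2 * w ^ 2 * Λ ≤ 32 * κ ^ 2 * (τ * ∑ t ∈ Finset.range τ, g t) := by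
  let N (e : ℕ) : ℕ := (Prod.fst '' P.emitted P.start x e).ncard
  have hN₀ : N 0 = 0 := by simp [N, P.emitted_zero]
  have hNτ : (N τ : ℝ) = n * n := by
    have : Prod.fst '' P.emitted P.start x τ = Set.univ := Set.eq_univ_of_forall fun j => by
      obtain ⟨t, ht, o, ho⟩ := hP.complete j
      exact ⟨(j, o), ⟨t, ht, ho⟩, rfl⟩
    simp [N, this, Set.ncard_univ]
  rw [← hNτ] at hbase ⊢
  refine sq_mul_le_sum_of_block_bound hP.cost_nonneg hΛ (by rwa [hP.cost_zero]) hw hκ hN₀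
    (fun s e i hse he hei hgs => ?_) hbase
  have hsplit : N e ≤ N s +
      (Prod.fst '' P.emitted (P.run P.start x s) x (2 ^ (i + 1) * w)).ncard := by
    refine le_trans (Set.ncard_le_ncard ?_ (Set.toFinite _)) (Set.ncard_union_le _ _)
    rw [← Set.image_union]
    exact Set.image_mono ((P.emitted_mono _ x hei).trans (P.emitted_add_subset _ x s _))
  have hlt := ncard_emitted_lt hP hτ hκ hadv (hse.trans_le he) hgs
  lia

theorem exists_mul_sum_cost_ge (C : ℕ) : ∃ ε > (0 : ℝ), ∀ K : ℕ, ∃ n₀ : ℕ, ∀ n ≥ n₀,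
    ∀ (F : Type u) [Field F] (D : Finset F), 2 ≤ D.card →
    ∀ (P : QueryMachine (Idx n) (Fin n × Fin n) D F) (cheap : ℕ → ℝ → Finset P.State),
    P.IsCheap K cheap → ∀ (G : Set (Idx n → D)) (τ : (Idx n → D) → ℕ)
    (g : (Idx n → D) → ℕ → ℝ) (T : ℕ),
    T ≤ ε * (n ^ 3 * √(Real.logb 2 D.card / Real.logb 2 n)) →
    (∀ x ∈ G, τ x ≤ T ∧ P.ComputesWithCost cheap (product x) x (τ x) (g x)) →
    (Fintype.card (Idx n → D) : ℝ) / n ^ C ≤ Nat.card G →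
    ∃ x ∈ G, ε * (n ^ 6 * Real.logb 2 D.card) ≤ T * ∑ t ∈ Finset.range (τ x), g x t := by
  obtain ⟨n₁, hn₁⟩ := exists_card_not_rigid_le.{u} C
  set A : ℕ := 4096 * (C + 6) with hA
  have hA₁ : (1 : ℝ) ≤ A := by exact_mod_cast (by lia : 1 ≤ A)
  refine ⟨1 / (2 ^ 32 * A), by positivity, fun K => ⟨n₁ + 128 + 32768 * K + 16 * A,
    fun n hn F _ D hD P cheap hcheap G τ g T hT hG hcard => ?_⟩⟩
  set ε : ℝ := 1 / (2 ^ 32 * A) with hε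
  have hε₀ : 0 < ε := by positivity
  have hε₁ : ε ≤ 1 / 2 ^ 32 := one_div_le_one_div_of_le (by norm_num) (by linarith)
  have hl := one_le_logb_two hD
  have hlg := one_le_logb_two (by lia : 2 ≤ n)
  obtain ⟨r, hr, hAr, hrn, hrA⟩ := exists_block_scale hl hlg (logb_two_natCast_le_self n) hA₁
    (by exact_mod_cast (by lia : 16 * A ≤ n))
  have hr' : (1 : ℝ) ≤ r := by exact_mod_cast hr
  have hm : (n : ℝ) / 256 ≤ (n / 128 : ℕ) := by
    rw [div_le_iff₀ (by norm_num)]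
    exact_mod_cast (by lia : n ≤ n / 128 * 256)
  obtain ⟨x, hxG, hx⟩ := exists_mem_not_advancesCheaply (κ := r ^ 2) (T := T)
    (q := fun i => 2 ^ (i + 1) * (n / 128 * r)) (by lia) (by lia) (by lia) hcheap
    (fun i => le_of_eq (by rw [show 4 = 2 ^ 2 by norm_num, ← pow_mul]; ring)) rfl
    (hn₁ n (by lia) F D hD)
    (mul_two_rpow_neg_le hl hlg (by exact_mod_cast Nat.one_le_pow _ _ hr)
      (by push_cast [hA] at hAr ⊢; exact hAr) (by lia)
      (hT.trans (mul_le_of_le_one_left (by positivity) (by linarith)))) hcard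
  obtain ⟨hτ, hP⟩ := hG x hxG
  have hτT : (τ x : ℝ) ≤ T := by exact_mod_cast hτ
  have hbase := base_output_le (τ := τ x) n.cast_nonneg hε₀.le
    (by rw [hε]; field_simp; norm_num) hr' hrn hrA hm (hτT.trans hT)
  have hcost := sq_mul_le_sum_cost hP hτ (Nat.one_le_pow _ _ hr) hx (by positivity)
    (Nat.mul_pos (by lia) hr) (by push_cast; exact hbase)
  push_cast at hcost
  refine ⟨x, hxG, (mul_pow_six_le n.cast_nonneg (by linarith) (by linarith) hε₁ hm hcost).trans ?_⟩
  have := Finset.sum_nonneg fun t (_ : t ∈ Finset.range (τ x)) => hP.cost_nonneg t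
  gcongr

end MatMul

namespace BranchingProgram

variable {ι κ D R : Type*} (P : BranchingProgram ι κ D R)

/-- A branching program as a query machine; `none` is the state after a sink. -/
def toQueryMachine : QueryMachine ι κ D R where
  State := Option (Σ t, Fin (P.width t))
  start := some ⟨0, ⟨0, by simp [P.width_zero]⟩⟩
  query v := v.bind fun u => P.query u.1 u.2
  next v a := v.bind fun u => a.map fun d => ⟨u.1 + 1, P.next u.1 u.2 d⟩
  emit v a := {e | ∃ u d, v = some u ∧ u.1 < P.time ∧ a = some d ∧ e ∈ P.out u.1 u.2 d}

theorem run_toQueryMachine (x : ι → D) (t : ℕ) :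
    P.toQueryMachine.run P.toQueryMachine.start x t = (P.node x t).map (Sigma.mk t) := by
  induction t with
  | zero => rfl
  | succ t ih =>
    rw [QueryMachine.run_succ, ih, node]
    rcases P.node x t with _ | v
    · rfl
    · simp only [toQueryMachine, Option.map_some, Option.bind_some, Option.map_map]
      rfl

theorem mem_emittedAt_toQueryMachine (x : ι → D) (t : ℕ) (e : κ × R) :
    e ∈ P.toQueryMachine.emittedAt P.toQueryMachine.start x t ↔ t < P.time ∧
      ∃ v i, P.node x t = some v ∧ P.query t v = some i ∧ e ∈ P.out t v (x i) := by
  rw [QueryMachine.emittedAt, run_toQueryMachine]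
  constructor
  · rintro ⟨u, d, hu, ht, hd, he⟩
    obtain ⟨v, hv, rfl⟩ := Option.map_eq_some_iff.1 hu
    rw [hv] at hd
    obtain ⟨i, hi, rfl⟩ := Option.map_eq_some_iff.1 hd
    exact ⟨ht, v, i, hv, hi, he⟩
  · rintro ⟨ht, v, i, hv, hi, he⟩
    rw [hv]
    exact ⟨⟨t, v⟩, x i, rfl, ht, Option.map_eq_some_iff.2 ⟨i, hi, rfl⟩, he⟩

theorem logb_width_nonneg (t : ℕ) : 0 ≤ Real.logb 2 (P.width t) :=
  div_nonneg (Real.log_natCast_nonneg _) (Real.log_nonneg (by norm_num))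

theorem width_le_two_rpow {t : ℕ} {y : ℝ} (h : Real.logb 2 (P.width t) ≤ y) :
    (P.width t : ℝ) ≤ 2 ^ y := by
  rcases Nat.eq_zero_or_pos (P.width t) with h₀ | h₀
  · rw [h₀, Nat.cast_zero]
    positivity
  · rwa [Real.logb_le_iff_le_rpow (by norm_num) (by exact_mod_cast h₀)] at h

/-- The possible states at time `s`, provided that layer `s` has at most `2 ^ y` nodes. -/
noncomputable def cheapStates (s : ℕ) (y : ℝ) : Finset (Option (Σ t, Fin (P.width t))) :=
  if Real.logb 2 (P.width s) ≤ y then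
    Finset.insertNone (Finset.univ.map (Function.Embedding.sigmaMk s))
  else ∅

theorem card_cheapStates_le (s : ℕ) {y : ℝ} (hy : 0 ≤ y) :
    ((P.cheapStates s y).card : ℝ) ≤ 2 * 2 ^ y := by
  unfold cheapStates
  split_ifs with h
  · have hone : (1 : ℝ) ≤ 2 ^ y := Real.one_le_rpow (by norm_num) hy
    have hwidth := P.width_le_two_rpow h
    rw [Finset.card_insertNone, Finset.card_map, Finset.card_fin]
    push_cast
    linarith
  · rw [Finset.card_empty, Nat.cast_zero]
    positivity

theorem isCheap_cheapStates : P.toQueryMachine.IsCheap 2 P.cheapStates :=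
  fun s _ hy => P.card_cheapStates_le s hy

theorem node_mem_cheapStates (x : ι → D) {s : ℕ} {y : ℝ} (h : Real.logb 2 (P.width s) ≤ y) :
    (P.node x s).map (Sigma.mk s) ∈ P.cheapStates s y := by
  rw [cheapStates, if_pos h, Finset.mem_insertNone]
  intro u hu
  obtain ⟨v, -, rfl⟩ := Option.map_eq_some_iff.1 hu
  exact Finset.mem_map_of_mem _ (Finset.mem_univ v)

theorem Produces.computesWithCost {P : BranchingProgram ι κ D R} {x : ι → D} {y : κ → R}
    (h : P.Produces x y) : P.toQueryMachine.ComputesWithCost P.cheapStates y x P.time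
      fun t => Real.logb 2 (P.width t) where
  cost_nonneg := P.logb_width_nonneg
  cost_zero := by rw [P.width_zero, Nat.cast_one, Real.logb_one]
  mem_cheap s _ y hy := by
    rw [run_toQueryMachine]
    exact P.node_mem_cheapStates x hy
  correct t e he := by
    obtain ⟨ht, hout⟩ := (P.mem_emittedAt_toQueryMachine x t e).1 he
    exact (h e.1 e.2).1 ⟨t, ht, hout⟩
  complete j := by
    obtain ⟨t, ht, hout⟩ := (h j (y j)).2 rfl
    exact ⟨t, ht, y j, (P.mem_emittedAt_toQueryMachine x t _).2 ⟨ht, hout⟩⟩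

theorem sum_logb_width_le_cumulativeMemory :
    ∑ t ∈ Finset.range P.time, Real.logb 2 (P.width t) ≤ P.cumulativeMemory := by
  rw [cumulativeMemory, Finset.sum_range_succ]
  exact le_add_of_nonneg_right (P.logb_width_nonneg _)

theorem exists_mul_cumulativeMemory_ge (C : ℕ) : ∃ ε > (0 : ℝ), ∃ n₀ : ℕ, ∀ n ≥ n₀,
    ∀ (F : Type u) [Field F] (D : Finset F), 2 ≤ D.card →
    ∀ (P : BranchingProgram (MatMul.Idx n) (Fin n × Fin n) D F) (T : ℕ), P.time ≤ T →
    T ≤ ε * (n ^ 3 * √(Real.logb 2 D.card / Real.logb 2 n)) →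
    (Fintype.card (MatMul.Idx n → D) : ℝ) / n ^ C ≤
      Nat.card {x | P.Produces x (MatMul.product x)} →
    ε * (n ^ 6 * Real.logb 2 D.card) ≤ T * P.cumulativeMemory := by
  obtain ⟨ε, hε, hbound⟩ := MatMul.exists_mul_sum_cost_ge.{u} C
  obtain ⟨n₀, hn₀⟩ := hbound 2
  refine ⟨ε, hε, n₀, fun n hn F _ D hD P T hPT hT hcard => ?_⟩
  obtain ⟨x, -, hx⟩ := hn₀ n hn F D hD P.toQueryMachine P.cheapStates P.isCheap_cheapStates
    {x | P.Produces x (MatMul.product x)} (fun _ => P.time)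
    (fun _ t => Real.logb 2 (P.width t)) T hT (fun x hx => ⟨hPT, hx.computesWithCost⟩) hcard
  exact hx.trans (mul_le_mul_of_nonneg_left P.sum_logb_width_le_cumulativeMemory T.cast_nonneg)

end BranchingProgram

theorem sum_finsupp_prod {ι α R : Type*} [Zero α] [CommSemiring R] (s : Finset ι)
    (t : ι → Finset α) (w : ι → α → R) :
    ∑ f ∈ s.finsupp t, ∏ i ∈ s, w i (f i) = ∏ i ∈ s, ∑ a ∈ t i, w i a := by
  classical
  rw [Finset.prod_sum, Finset.finsupp, Finset.sum_map]
  refine Finset.sum_congr rfl fun p _ => ?_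
  rw [← Finset.prod_attach]
  refine Finset.prod_congr rfl fun i _ => ?_
  exact congrArg (w i) (Finsupp.indicator_of_mem i.2 p)

namespace RAM

theorem one_div_four_pow_size_le (k : ℕ) :
    (1 / 4 : ℝ) ^ Nat.size k ≤ (((k + 1 : ℕ) : ℝ) ^ 2)⁻¹ := by
  rw [one_div, inv_pow]
  refine inv_anti₀ (by positivity) ?_
  rw [show (4 : ℝ) = 2 ^ 2 by norm_num, ← pow_mul, mul_comm, pow_mul]
  gcongr
  exact_mod_cast Nat.lt_size_self k

theorem sum_one_div_four_pow_size_le (N : ℕ) :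
    ∑ k ∈ Finset.range N, (1 / 4 : ℝ) ^ Nat.size k ≤ 2 := by
  calc _ ≤ ∑ k ∈ Finset.range N, (((k + 1 : ℕ) : ℝ) ^ 2)⁻¹ :=
        Finset.sum_le_sum fun k _ => one_div_four_pow_size_le k
    _ = ∑ i ∈ Finset.Ioo 0 (N + 1), ((i : ℝ) ^ 2)⁻¹ := by
        rw [Finset.range_eq_Ico, Finset.sum_Ico_add' (fun i : ℕ => ((i : ℝ) ^ 2)⁻¹) 0 N 1]
        rfl
    _ ≤ 2 := by simpa using sum_Ioo_inv_sq_le (α := ℝ) 0 (N + 1)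

/-- The logarithmic-cost space of register contents, so that `s.space = registerSpace s.reg`. -/
def registerSpace (f : ℕ →₀ ℕ) : ℕ := f.sum fun r v => Nat.size r + Nat.size v

/-- The contribution of register `r` with content `v` to `(1 / 4) ^ registerSpace f`. -/
noncomputable def registerWeight (r v : ℕ) : ℝ :=
  if v = 0 then 1 else (1 / 4) ^ (Nat.size r + Nat.size v)

theorem registerWeight_nonneg (r v : ℕ) : 0 ≤ registerWeight r v := by
  unfold registerWeight
  positivity

theorem prod_registerWeight {f : ℕ →₀ ℕ} {s : Finset ℕ} (hf : f.support ⊆ s) :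
    ∏ r ∈ s, registerWeight r (f r) = (1 / 4) ^ registerSpace f := by
  rw [registerSpace, Finsupp.sum, ← Finset.prod_pow_eq_pow_sum,
    ← Finsupp.prod_of_support_subset f hf registerWeight fun r _ => if_pos rfl]
  exact Finset.prod_congr rfl fun r hr => if_neg (Finsupp.mem_support_iff.1 hr)

theorem sum_registerWeight_le (r N : ℕ) :
    ∑ v ∈ Finset.range N, registerWeight r v ≤ Real.exp (2 * (1 / 4) ^ Nat.size r) := by
  have hle (v : ℕ) : registerWeight r v ≤
      (if v = 0 then 1 else 0) + (1 / 4) ^ Nat.size r * (1 / 4) ^ Nat.size v := by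
    rw [← pow_add, registerWeight]
    split_ifs with hv
    · exact le_add_of_nonneg_right (by positivity)
    · rw [zero_add]
  calc _ ≤ ∑ v ∈ Finset.range N,
        ((if v = 0 then 1 else 0) + (1 / 4 : ℝ) ^ Nat.size r * (1 / 4) ^ Nat.size v) :=
        Finset.sum_le_sum fun v _ => hle v
    _ = (if 0 ∈ Finset.range N then 1 else 0) +
          (1 / 4) ^ Nat.size r * ∑ v ∈ Finset.range N, (1 / 4 : ℝ) ^ Nat.size v := by
        rw [Finset.sum_add_distrib, Finset.sum_ite_eq', Finset.mul_sum]
    _ ≤ 1 + (1 / 4) ^ Nat.size r * 2 := by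
        gcongr
        · split_ifs <;> norm_num
        · exact sum_one_div_four_pow_size_le N
    _ ≤ Real.exp (2 * (1 / 4) ^ Nat.size r) := by
        rw [add_comm, mul_comm]
        exact Real.add_one_le_exp _

theorem sum_one_div_four_pow_registerSpace_le (N : ℕ) :
    ∑ f ∈ (Finset.range N).finsupp fun _ => Finset.range N, (1 / 4 : ℝ) ^ registerSpace f ≤ 81 := by
  calc _ = ∏ r ∈ Finset.range N, ∑ v ∈ Finset.range N, registerWeight r v := by
        rw [← sum_finsupp_prod]
        exact Finset.sum_congr rfl fun f hf =>
          (prod_registerWeight (Finset.mem_finsupp_iff.1 hf).1).symm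
    _ ≤ ∏ r ∈ Finset.range N, Real.exp (2 * (1 / 4) ^ Nat.size r) :=
        Finset.prod_le_prod (fun r _ => Finset.sum_nonneg fun v _ => registerWeight_nonneg r v)
          fun r _ => sum_registerWeight_le r N
    _ = Real.exp (2 * ∑ r ∈ Finset.range N, (1 / 4) ^ Nat.size r) := by
        rw [← Real.exp_sum, Finset.mul_sum]
    _ ≤ Real.exp (2 * 2) := by
        gcongr
        exact sum_one_div_four_pow_size_le N
    _ = Real.exp 1 ^ 4 := by
        rw [← Real.exp_nat_mul]
        norm_num
    _ ≤ 3 ^ 4 := by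
        gcongr
        exact Real.exp_one_lt_three.le
    _ = 81 := by norm_num

/-- The register contents of space at most `σ`; addresses and contents are then below `2 ^ σ`. -/
noncomputable def smallRegisters (σ : ℕ) : Finset (ℕ →₀ ℕ) :=
  ((Finset.range (2 ^ σ)).finsupp fun _ => Finset.range (2 ^ σ)).filter (registerSpace · ≤ σ)

theorem size_add_size_le_registerSpace {f : ℕ →₀ ℕ} {r : ℕ} (hr : f r ≠ 0) :
    Nat.size r + Nat.size (f r) ≤ registerSpace f :=
  Finset.single_le_sum (f := fun r => Nat.size r + Nat.size (f r)) (fun _ _ => Nat.zero_le _)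
    (Finsupp.mem_support_iff.2 hr)

theorem mem_smallRegisters {σ : ℕ} {f : ℕ →₀ ℕ} : f ∈ smallRegisters σ ↔ registerSpace f ≤ σ := by
  refine ⟨fun hf => (Finset.mem_filter.1 hf).2, fun hf => Finset.mem_filter.2 ⟨?_, hf⟩⟩
  have hsize (r : ℕ) (hr : f r ≠ 0) := (size_add_size_le_registerSpace hr).trans hf
  refine Finset.mem_finsupp_iff.2 ⟨fun r hr => ?_, fun r _ => ?_⟩ <;> rw [Finset.mem_range]
  · have := hsize r (Finsupp.mem_support_iff.1 hr)
    exact Nat.size_le.1 (by lia)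
  · by_cases hr : f r = 0
    · rw [hr]
      positivity
    · have := hsize r hr
      exact Nat.size_le.1 (by lia)

theorem card_smallRegisters_le (σ : ℕ) : ((smallRegisters σ).card : ℝ) ≤ 81 * 4 ^ σ := by
  have hsum : ((smallRegisters σ).card : ℝ) * (1 / 4) ^ σ ≤ 81 := by
    rw [← nsmul_eq_mul]
    refine (Finset.card_nsmul_le_sum _ (fun f => (1 / 4 : ℝ) ^ registerSpace f) _
      fun f hf => ?_).trans ((Finset.sum_le_sum_of_subset_of_nonneg (Finset.filter_subset _ _)
      fun _ _ _ => by positivity).trans (sum_one_div_four_pow_registerSpace_le (2 ^ σ)))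
    exact pow_le_pow_of_le_one (by norm_num) (by norm_num) (mem_smallRegisters.1 hf)
  rwa [one_div_pow, mul_one_div, div_le_iff₀ (by positivity)] at hsum

/-- The configurations of space at most `σ` with one of the first `L` instructions to be executed
next. -/
noncomputable def smallConfigs (L σ : ℕ) : Finset Config :=
  (Finset.range L ×ˢ smallRegisters σ).map
    ⟨fun p => ⟨p.1, p.2⟩, fun _ _ h => Prod.ext (congrArg Config.pc h) (congrArg Config.reg h)⟩

theorem mem_smallConfigs {L σ : ℕ} {s : Config} :
    s ∈ smallConfigs L σ ↔ s.pc < L ∧ s.space ≤ σ := by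
  rw [smallConfigs, Finset.mem_map]
  constructor
  · rintro ⟨⟨pc, f⟩, hp, rfl⟩
    obtain ⟨hpc, hf⟩ := Finset.mem_product.1 hp
    exact ⟨Finset.mem_range.1 hpc, mem_smallRegisters.1 hf⟩
  · rintro ⟨hpc, hf⟩
    exact ⟨(s.pc, s.reg), Finset.mk_mem_product (Finset.mem_range.2 hpc)
      (mem_smallRegisters.2 hf), rfl⟩

theorem card_smallConfigs_le (L σ : ℕ) : ((smallConfigs L σ).card : ℝ) ≤ 81 * L * 4 ^ σ := by
  rw [smallConfigs, Finset.card_map, Finset.card_product, Finset.card_range, Nat.cast_mul,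
    mul_comm 81, mul_assoc]
  gcongr
  exact card_smallRegisters_le σ

end RAM

theorem mul_succ_le_two_mul_sum {a : ℕ → ℕ} {τ σ : ℕ}
    (h : 2 * ((Finset.range τ).filter fun t => a t ≤ σ).card ≤ τ) :
    τ * (σ + 1) ≤ 2 * ∑ t ∈ Finset.range τ, a t := by
  have hsplit := Finset.card_filter_add_card_filter_not (s := Finset.range τ) fun t => a t ≤ σ
  rw [Finset.card_range] at hsplit
  set large := (Finset.range τ).filter fun t => ¬ a t ≤ σ
  have hlarge : large.card * (σ + 1) ≤ ∑ t ∈ Finset.range τ, a t :=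
    (Finset.card_nsmul_le_sum large a _ fun t ht => not_le.1 (Finset.mem_filter.1 ht).2).trans
      (Finset.sum_le_sum_of_subset (Finset.filter_subset _ _))
  calc τ * (σ + 1) ≤ 2 * large.card * (σ + 1) := Nat.mul_le_mul_right _ (by lia)
    _ = 2 * (large.card * (σ + 1)) := mul_assoc _ _ _
    _ ≤ 2 * ∑ t ∈ Finset.range τ, a t := Nat.mul_le_mul_left 2 hlarge

theorem logb_two_le_log_four (n : ℕ) : Real.logb 2 n ≤ 2 * (Nat.log 4 n + 1 : ℕ) := by
  rcases Nat.eq_zero_or_pos n with rfl | hn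
  · rw [Nat.cast_zero, Real.logb_zero]
    positivity
  · rw [Real.logb_le_iff_le_rpow (by norm_num) (by exact_mod_cast hn), ← Nat.cast_ofNat (R := ℝ),
      ← Nat.cast_mul, Real.rpow_natCast, pow_mul]
    exact_mod_cast (Nat.lt_pow_succ_log_self (by norm_num) n).le

namespace RAM

/-- The machine halts for the first time after `τ` steps. -/
def HaltsAt (M : Program) (w : ℕ → ℕ) (τ : ℕ) : Prop :=
  Halted M (config M w τ) ∧ ∀ t < τ, ¬ Halted M (config M w t)

theorem config_add (M : Program) (w : ℕ → ℕ) (s t : ℕ) :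
    config M w (s + t) = (step M w)^[t] (config M w s) := by
  unfold config
  rw [add_comm, Function.iterate_add_apply]

variable {M : Program} {w : ℕ → ℕ} {τ : ℕ}

theorem step_of_halted {s : Config} (h : Halted M s) : step M w s = s := by
  rw [step, List.getElem?_eq_none h]

theorem HaltsAt.halted (h : HaltsAt M w τ) {t : ℕ} (ht : τ ≤ t) : Halted M (config M w t) := by
  obtain ⟨k, rfl⟩ := Nat.exists_eq_add_of_le ht
  rw [config_add, Function.iterate_fixed (step_of_halted h.1)]
  exact h.1

theorem HaltsAt.pc_lt (h : HaltsAt M w τ) {t : ℕ} (ht : t < τ) : (config M w t).pc < M.length :=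
  not_le.1 (h.2 t ht)

theorem HaltsAt.lt_of_getElem?_eq_some (h : HaltsAt M w τ) {t : ℕ} {I : Instr}
    (hI : M[(config M w t).pc]? = some I) : t < τ := by
  by_contra! ht
  rw [List.getElem?_eq_none (h.halted ht)] at hI
  exact Option.some_ne_none I hI.symm

-- A repeated configuration would make the run periodic, and it would never halt.
theorem HaltsAt.config_ne (h : HaltsAt M w τ) {s t : ℕ} (hst : s < t) (ht : t < τ) :
    config M w s ≠ config M w t := by
  intro heq
  refine h.2 (s + (τ - t)) (by lia) ?_
  rw [config_add, heq, ← config_add, Nat.add_sub_cancel' ht.le]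
  exact h.1

theorem HaltsAt.injOn_config (h : HaltsAt M w τ) :
    Set.InjOn (config M w) (Finset.range τ : Set ℕ) := by
  intro s hs t ht heq
  rcases lt_trichotomy s t with hlt | rfl | hlt
  · exact absurd heq (h.config_ne hlt (Finset.mem_range.1 ht))
  · rfl
  · exact absurd heq.symm (h.config_ne hlt (Finset.mem_range.1 hs))

theorem HaltsAt.card_filter_space_le (h : HaltsAt M w τ) (σ : ℕ) :
    (((Finset.range τ).filter fun t => (config M w t).space ≤ σ).card : ℝ) ≤
      81 * M.length * 4 ^ σ := by
  refine le_trans (Nat.cast_le.2 ?_) (card_smallConfigs_le M.length σ)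
  refine Finset.card_le_card_of_injOn (config M w) (fun t ht => ?_)
    (h.injOn_config.mono (by exact_mod_cast Finset.filter_subset _ _))
  obtain ⟨ht, hspace⟩ := Finset.mem_filter.1 ht
  exact mem_smallConfigs.2 ⟨h.pc_lt (Finset.mem_range.1 ht), hspace⟩

theorem HaltsAt.mul_logb_le {n : ℕ} (h : HaltsAt M w τ)
    (hn : n * n ≤ τ) (hM : 162 * M.length + 1 ≤ n) :
    τ * Real.logb 2 n ≤ 4 * ∑ t ∈ Finset.range τ, ((config M w t).space : ℝ) := by
  set σ := Nat.log 4 n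
  have hpow : 4 ^ σ ≤ n := Nat.pow_log_le_self 4 (by lia)
  have hcard : ((Finset.range τ).filter fun t => (config M w t).space ≤ σ).card ≤
      81 * M.length * 4 ^ σ := by exact_mod_cast h.card_filter_space_le σ
  have hfew : 2 * ((Finset.range τ).filter fun t => (config M w t).space ≤ σ).card ≤ τ :=
    calc _ ≤ 2 * (81 * M.length * n) := by gcongr; exact hcard.trans (by gcongr)
      _ = 162 * M.length * n := by ring
      _ ≤ n * n := by gcongr; lia
      _ ≤ τ := hn
  calc τ * Real.logb 2 n ≤ τ * (2 * (σ + 1 : ℕ)) := by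
        gcongr
        exact logb_two_le_log_four n
    _ = 2 * ((τ * (σ + 1) : ℕ) : ℝ) := by push_cast; ring
    _ ≤ 2 * ((2 * ∑ t ∈ Finset.range τ, (config M w t).space : ℕ) : ℝ) := by
        exact mul_le_mul_of_nonneg_left (Nat.cast_le.2 (mul_succ_le_two_mul_sum hfew)) zero_le_two
    _ = 4 * ∑ t ∈ Finset.range τ, ((config M w t).space : ℝ) := by push_cast; ring

end RAM

theorem le_mul_sqrt_div {ε l lg m s T τ : ℝ} (hε : 0 ≤ ε) (hm : 0 ≤ m) (hlg : 0 < lg) (hl : 0 ≤ l)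
    (hτ : 0 ≤ τ) (hτT : τ ≤ T) (hs : τ * lg ≤ 4 * s) (hTs : T * s ≤ ε ^ 2 / 4 * (m ^ 2 * l)) :
    τ ≤ ε * (m * √(l / lg)) := by
  have hsq : τ ^ 2 * lg ≤ ε ^ 2 * (m ^ 2 * l) := by
    calc τ ^ 2 * lg = τ * (τ * lg) := by ring
      _ ≤ T * (4 * s) := mul_le_mul hτT hs (by positivity) (hτ.trans hτT)
      _ ≤ ε ^ 2 * (m ^ 2 * l) := by linarith
  refine le_of_sq_le_sq ?_ (by positivity)
  rw [mul_pow, mul_pow, Real.sq_sqrt (by positivity), ← mul_div_assoc, ← mul_div_assoc]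
  rwa [le_div_iff₀ hlg]

namespace MatMul

variable {F : Type*} {n : ℕ} {D : Finset F}

/-- The input coordinate stored in cell `k`. -/
def cell (n k : ℕ) : Option (Idx n) :=
  if h : k < n * n then some (.inl (finProdFinEquiv.symm ⟨k, h⟩))
  else if h : k - n * n < n * n then some (.inr (finProdFinEquiv.symm ⟨k - n * n, h⟩))
  else none

theorem elim_map_cell (enc : F ↪ ℕ) (x : Idx n → D) (k : ℕ) :
    ((cell n k).map x).elim 0 (fun d => enc d) = tape enc x k := by
  unfold cell tape
  split_ifs <;> rfl

/-- A random-access machine as a query machine. -/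
noncomputable def ramMachine (M : RAM.Program) (enc : F ↪ ℕ) :
    QueryMachine (Idx n) (Fin n × Fin n) D F where
  State := RAM.Config
  start := ⟨0, 0⟩
  query s := match M[s.pc]? with
    | some (.read _ a) => cell n (s.reg a)
    | _ => none
  next s d := RAM.step M (fun _ => d.elim 0 fun d => enc d) s
  emit s _ := {e | ∃ a b, M[s.pc]? = some (.write a b) ∧ s.reg a = e.1.1 * n + e.1.2 ∧
    s.reg b = enc e.2}

variable {M : RAM.Program} {enc : F ↪ ℕ} {x : Idx n → D} {τ : ℕ}

variable (M enc x) in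
theorem run_ramMachine (t : ℕ) :
    (ramMachine M enc).run (ramMachine M enc : QueryMachine (Idx n) _ D F).start x t =
      RAM.config M (tape enc x) t := by
  refine congrArg (fun f : RAM.Config → RAM.Config => f^[t] ⟨0, 0⟩) (funext fun s => ?_)
  simp only [ramMachine]
  unfold RAM.step
  split <;> rename_i hM <;> try rfl
  rw [hM, elim_map_cell]

theorem mem_emittedAt_ramMachine {t : ℕ} {e : (Fin n × Fin n) × F} :
    e ∈ (ramMachine M enc).emittedAt (ramMachine M enc).start x t ↔
      ∃ a b, M[(RAM.config M (tape enc x) t).pc]? = some (.write a b) ∧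
        (RAM.config M (tape enc x) t).reg a = e.1.1 * n + e.1.2 ∧
        (RAM.config M (tape enc x) t).reg b = enc e.2 := by
  rw [QueryMachine.emittedAt, run_ramMachine]
  rfl

theorem rowMajor_injective {p q : Fin n × Fin n} (h : (p.1 : ℕ) * n + p.2 = q.1 * n + q.2) :
    p = q := by
  apply finProdFinEquiv.injective
  apply Fin.ext
  simp only [finProdFinEquiv_apply_val]
  rw [add_comm, mul_comm, h, add_comm, mul_comm]

theorem sq_le_of_forall_mem_emittedAt (h : ∀ j, ∃ t < τ, ∃ o,
    (j, o) ∈ (ramMachine M enc).emittedAt (ramMachine M enc).start x t) : n * n ≤ τ := by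
  choose t ht o ho using h
  have hinj : Function.Injective t := by
    intro j j' hjj
    obtain ⟨a, b, hM, ha, -⟩ := mem_emittedAt_ramMachine.1 (ho j)
    obtain ⟨a', b', hM', ha', -⟩ := mem_emittedAt_ramMachine.1 (ho j')
    rw [← hjj] at hM' ha'
    cases hM.symm.trans hM'
    exact rowMajor_injective (ha.symm.trans ha')
  simpa using Finset.card_le_card_of_injOn (s := Finset.univ) (t := Finset.range τ) t
    (fun j _ => Finset.mem_coe.2 (Finset.mem_range.2 (ht j))) hinj.injOn

theorem isCheap_smallConfigs (L : ℕ) :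
    (ramMachine M enc : QueryMachine (Idx n) _ D F).IsCheap (81 * L)
      fun _ y => RAM.smallConfigs L ⌊y / 2⌋₊ := by
  intro _ y hy
  refine (RAM.card_smallConfigs_le _ _).trans ?_
  push_cast
  gcongr
  rw [← Real.rpow_natCast, show (4 : ℝ) = 2 ^ (2 : ℝ) by norm_num, ← Real.rpow_mul (by norm_num)]
  refine Real.rpow_le_rpow_of_exponent_le (by norm_num) ?_
  linarith [Nat.floor_le (div_nonneg hy zero_le_two)]

variable [Field F]

theorem RAMProduces.computesWithCost {L : ℕ} (hx : RAMProduces M enc x) (hM : M.length ≤ L)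
    (hτ : RAM.HaltsAt M (tape enc x) τ) :
    (ramMachine M enc).ComputesWithCost (fun _ y => RAM.smallConfigs L ⌊y / 2⌋₊) (product x) x τ
      fun t => 2 * (RAM.config M (tape enc x) t).space where
  cost_nonneg _ := by positivity
  cost_zero := by simp [RAM.config, RAM.Config.space]
  mem_cheap s hs y hy := by
    rw [run_ramMachine]
    exact RAM.mem_smallConfigs.2 ⟨(hτ.pc_lt hs).trans_le hM, Nat.le_floor (by linarith)⟩
  correct t e he := by
    obtain ⟨a, b, hwrite, ha, hb⟩ := mem_emittedAt_ramMachine.1 he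
    obtain ⟨i, j, hij, hv⟩ := (hx _ _).1 ⟨t, a, b, hwrite, ha, hb⟩
    rw [enc.injective hv, rowMajor_injective (q := (i, j)) hij]
  complete j := by
    obtain ⟨t, a, b, hwrite, ha, hb⟩ := (hx _ _).2 ⟨j.1, j.2, rfl, rfl⟩
    exact ⟨t, hτ.lt_of_getElem?_eq_some hwrite, product x j,
      mem_emittedAt_ramMachine.2 ⟨a, b, hwrite, ha, hb⟩⟩

theorem RAMProduces.time_le {ε : ℝ} {T S : ℕ} (hn : 162 * M.length + 2 ≤ n) (hε : 0 ≤ ε)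
    (hx : RAMProduces M enc x) (hτ : RAM.HaltsAt M (tape enc x) τ) (hτT : τ ≤ T)
    (hS : ∑ t ∈ Finset.range τ, (RAM.config M (tape enc x) t).space ≤ S)
    (hTS : T * S ≤ ε ^ 2 / 4 * (n ^ 6 * Real.logb 2 D.card)) :
    τ ≤ ε * (n ^ 3 * √(Real.logb 2 D.card / Real.logb 2 n)) := by
  have htime := hτ.mul_logb_le
    (sq_le_of_forall_mem_emittedAt (hx.computesWithCost le_rfl hτ).complete) (by lia)
  refine le_mul_sqrt_div hε (by positivity) (zero_lt_one.trans_le (one_le_logb_two (by lia)))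
    (div_nonneg (Real.log_natCast_nonneg _) (Real.log_nonneg (by norm_num))) τ.cast_nonneg
    (Nat.cast_le.2 hτT) (htime.trans ?_) (by rwa [← pow_mul])
  gcongr
  exact_mod_cast hS

theorem exists_le_mul_of_runsWithin (C : ℕ) : ∃ ε > (0 : ℝ), ∀ L : ℕ, ∃ n₀ : ℕ, ∀ n ≥ n₀,
    ∀ (F : Type u) [Field F] (D : Finset F), 2 ≤ D.card →
    ∀ (enc : F ↪ ℕ) (M : RAM.Program) (T S : ℕ), M.length ≤ L →
    (∀ x : Idx n → D, RAM.RunsWithin M (tape enc x) T S) →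
    (Fintype.card (Idx n → D) : ℝ) / n ^ C ≤ Nat.card {x : Idx n → D | RAMProduces M enc x} →
    ε * (n ^ 6 * Real.logb 2 D.card) ≤ T * S := by
  obtain ⟨ε, hε, hbound⟩ := exists_mul_sum_cost_ge.{u} C
  refine ⟨min (ε ^ 2 / 4) (ε / 2), by positivity, fun L => ?_⟩
  obtain ⟨n₀, hn₀⟩ := hbound (81 * L)
  refine ⟨n₀ + 162 * L + 2, fun n hn F _ D hD enc M T S hM hrun hcard => ?_⟩
  by_contra! hTS
  have hlog : 0 ≤ Real.logb 2 D.card := zero_le_one.trans (one_le_logb_two hD)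
  rw [min_mul_of_nonneg _ _ (by positivity), lt_min_iff] at hTS
  choose τ hτT hhalt hnot hspace using hrun
  have hτ (x : Idx n → D) : RAM.HaltsAt M (tape enc x) (τ x) := ⟨hhalt x, hnot x⟩
  have hS (x : Idx n → D) :
      ∑ t ∈ Finset.range (τ x), (RAM.config M (tape enc x) t).space ≤ S :=
    (Finset.sum_le_sum_of_subset (Finset.range_subset_range.2 (τ x).le_succ)).trans (hspace x)
  set b := ε * (n ^ 3 * √(Real.logb 2 D.card / Real.logb 2 n))
  obtain ⟨x, -, hcost⟩ := hn₀ n (by lia) F D hD (ramMachine M enc) _ (isCheap_smallConfigs L)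
    {x | RAMProduces M enc x} τ (fun x t => 2 * (RAM.config M (tape enc x) t).space) (min T ⌊b⌋₊)
    ((Nat.cast_le.2 (min_le_right _ _)).trans (Nat.floor_le (by positivity)))
    (fun x hx => ⟨le_min (hτT x) (Nat.le_floor
      (RAMProduces.time_le (by lia) hε.le hx (hτ x) (hτT x) (hS x) hTS.1.le)),
      hx.computesWithCost hM (hτ x)⟩) hcard
  have hle : ((min T ⌊b⌋₊ : ℕ) : ℝ) *
      ∑ t ∈ Finset.range (τ x), 2 * ((RAM.config M (tape enc x) t).space : ℝ) ≤ T * (2 * S) := by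
    rw [← Finset.mul_sum]
    gcongr
    · exact min_le_left _ _
    · exact_mod_cast hS x
  linarith [hTS.2]

end MatMul

theorem exists_mem_support_le_of_le_tsum {α : Type*} (μ : PMF α) {f : α → ℝ}
    (hf₀ : ∀ a, 0 ≤ f a) (hf₁ : ∀ a, f a ≤ 1) {p : ℝ} (h : p ≤ ∑' a, (μ a).toReal * f a) :
    ∃ a ∈ μ.support, p ≤ f a := by
  by_contra! hlt
  have hone : HasSum (fun a => (μ a).toReal) 1 := by
    have hsum := ENNReal.hasSum_toReal μ.tsum_coe_ne_top
    rwa [← ENNReal.tsum_toReal_eq μ.apply_ne_top, μ.tsum_coe, ENNReal.toReal_one] at hsum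
  have hsummable : Summable fun a => (μ a).toReal * f a :=
    hone.summable.of_nonneg_of_le (fun a => mul_nonneg ENNReal.toReal_nonneg (hf₀ a))
      fun a => mul_le_of_le_one_right ENNReal.toReal_nonneg (hf₁ a)
  obtain ⟨a₀, ha₀⟩ := μ.support_nonempty
  have htsum : ∑' a, (μ a).toReal * f a < ∑' a, (μ a).toReal * p := by
    refine Summable.tsum_lt_tsum (i := a₀) (fun a => ?_) ?_ hsummable (hone.summable.mul_right p)
    · by_cases ha : a ∈ μ.support
      · exact mul_le_mul_of_nonneg_left (hlt a ha).le ENNReal.toReal_nonneg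
      · rw [(μ.apply_eq_zero_iff a).2 ha, ENNReal.toReal_zero, zero_mul, zero_mul]
    · exact mul_lt_mul_of_pos_left (hlt a₀ ha₀)
        (ENNReal.toReal_pos ((μ.mem_support_iff a₀).1 ha₀) (μ.apply_ne_top a₀))
  rw [tsum_mul_right, hone.tsum_eq, one_mul] at htsum
  exact htsum.not_ge h

theorem logb_natCast_eq_zero {m : ℕ} (hm : m < 2) : Real.logb 2 m = 0 := by
  interval_cases m <;> simp

theorem sqrt_div_logb_le_sqrt_div (l : ℝ) (n : ℕ) :
    √l / Real.logb 2 n ≤ √(l / Real.logb 2 n) := by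
  rcases lt_or_ge n 2 with hn | hn
  · rw [logb_natCast_eq_zero hn, div_zero]
    exact Real.sqrt_nonneg _
  · have hlog := one_le_logb_two hn
    rw [Real.sqrt_div' _ (by linarith)]
    gcongr
    exact Real.sqrt_le_left (by linarith) |>.2 (by nlinarith)

namespace MatMul

variable {F : Type*} {n : ℕ} {D : Finset F}

theorem prob_nonneg (E : (Idx n → D) → Prop) : 0 ≤ prob E := by
  unfold prob
  positivity

theorem prob_le_one (E : (Idx n → D) → Prop) : prob E ≤ 1 :=
  div_le_one_of_le₀ (Nat.cast_le.2 (Nat.card_le_card_of_injective _ Subtype.val_injective))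
    (Nat.cast_nonneg _)

theorem card_div_pow_le_of_le_prob {C : ℕ} {c : ℝ} (hc : c ≤ C) (hn : 1 ≤ n) (hD : 1 ≤ D.card)
    {E : (Idx n → D) → Prop} (h : (n : ℝ) ^ (-c) ≤ prob E) :
    (Fintype.card (Idx n → D) : ℝ) / n ^ C ≤ Nat.card {x | E x} := by
  have hn' : (1 : ℝ) ≤ n := by exact_mod_cast hn
  have hcard : (0 : ℝ) < Nat.card (Idx n → D) := by
    rw [Nat.card_eq_fintype_card, card_input]
    positivity
  have hpow : ((n : ℝ) ^ C)⁻¹ ≤ prob E := by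
    rw [← Real.rpow_natCast, ← Real.rpow_neg (by linarith)]
    exact (Real.rpow_le_rpow_of_exponent_le hn' (by linarith)).trans h
  rw [prob, le_div_iff₀ hcard, Nat.card_eq_fintype_card (α := Idx n → D)] at hpow
  rwa [div_eq_inv_mul]

end MatMul

theorem mainTheorem6_general (c : ℝ) :
    (∃ ε > (0 : ℝ), ∃ n₀ : ℕ, ∀ n ≥ n₀,
      ∀ (F : Type u) [Field F] (D : Finset F)
        (μ : PMF (BranchingProgram (MatMul.Idx n) (Fin n × Fin n) D F)) (T : ℕ) (S : ℝ),
        (∀ P ∈ μ.support, P.time ≤ T ∧ P.cumulativeMemory ≤ S) →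
        (n : ℝ) ^ (-c) ≤
          ∑' P, (μ P).toReal * MatMul.prob (fun x => P.Produces x (MatMul.product x)) →
        ε * ((n : ℝ) ^ 3 * √(Real.logb 2 D.card / Real.logb 2 n)) ≤ T ∨
          ε * ((n : ℝ) ^ 6 * Real.logb 2 D.card) ≤ T * S) ∧
    (∃ ε > (0 : ℝ), ∀ L : ℕ, ∃ n₀ : ℕ, ∀ n ≥ n₀,
      ∀ (F : Type u) [Field F] (D : Finset F) (enc : F ↪ ℕ)
        (μ : PMF RAM.Program) (T S : ℕ),
        (∀ M ∈ μ.support, M.length ≤ L ∧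
          ∀ x : MatMul.Idx n → D, RAM.RunsWithin M (MatMul.tape enc x) T S) →
        (n : ℝ) ^ (-c) ≤
          ∑' M, (μ M).toReal *
            MatMul.prob (fun x : MatMul.Idx n → D => MatMul.RAMProduces M enc x) →
        ε * ((n : ℝ) ^ 6 * Real.logb 2 D.card) ≤ T * S) := by
  obtain ⟨C, hC⟩ := exists_nat_ge c
  constructor
  · obtain ⟨ε, hε, n₀, hbound⟩ := BranchingProgram.exists_mul_cumulativeMemory_ge.{u} C
    refine ⟨ε, hε, n₀ + 1, fun n hn F _ D μ T S hμ hp => ?_⟩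
    rcases lt_or_ge D.card 2 with hD | hD
    · simp [logb_natCast_eq_zero hD]
    obtain ⟨P, hP, hprob⟩ := exists_mem_support_le_of_le_tsum μ
      (fun _ => MatMul.prob_nonneg _) (fun _ => MatMul.prob_le_one _) hp
    obtain ⟨hPT, hPS⟩ := hμ P hP
    refine or_iff_not_imp_left.2 fun hT => (hbound n (by lia) F D hD P T hPT (not_le.1 hT).le
      (MatMul.card_div_pow_le_of_le_prob hC (by lia) (by lia) hprob)).trans ?_
    gcongr
  · obtain ⟨ε, hε, hbound⟩ := MatMul.exists_le_mul_of_runsWithin.{u} C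
    refine ⟨ε, hε, fun L => ?_⟩
    obtain ⟨n₀, hbound⟩ := hbound L
    refine ⟨n₀ + 1, fun n hn F _ D enc μ T S hμ hp => ?_⟩
    rcases lt_or_ge D.card 2 with hD | hD
    · rw [logb_natCast_eq_zero hD, mul_zero, mul_zero]
      positivity
    obtain ⟨M, hM, hprob⟩ := exists_mem_support_le_of_le_tsum μ
      (fun _ => MatMul.prob_nonneg _) (fun _ => MatMul.prob_le_one _) hp
    exact hbound n (by lia) F D hD enc M T S (hμ M hM).1 (hμ M hM).2
      (MatMul.card_div_pow_le_of_le_prob hC (by lia) (by lia) hprob)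

/-- A randomized program is a probability distribution on deterministic ones. -/
theorem mainTheorem6 (c : ℝ) :
    (∃ ε > (0 : ℝ), ∃ n₀ : ℕ, ∀ n ≥ n₀,
      ∀ (F : Type u) [Field F] [Finite F] (D : Finset F)
        (μ : PMF (BranchingProgram (MatMul.Idx n) (Fin n × Fin n) D F)) (T : ℕ) (S : ℝ),
        (∀ P ∈ μ.support, P.time ≤ T ∧ P.cumulativeMemory ≤ S) →
        (n : ℝ) ^ (-c) ≤
          ∑' P, (μ P).toReal * MatMul.prob (fun x => P.Produces x (MatMul.product x)) →
        ε * ((n : ℝ) ^ 3 * √(Real.logb 2 D.card) / Real.logb 2 n) ≤ T ∨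
          ε * ((n : ℝ) ^ 6 * Real.logb 2 D.card) ≤ T * S) ∧
    (∃ ε > (0 : ℝ), ∀ L : ℕ, ∃ n₀ : ℕ, ∀ n ≥ n₀,
      ∀ (F : Type u) [Field F] [Finite F] (D : Finset F) (enc : F ↪ ℕ)
        (μ : PMF RAM.Program) (T S : ℕ),
        (∀ M ∈ μ.support, M.length ≤ L ∧
          ∀ x : MatMul.Idx n → D, RAM.RunsWithin M (MatMul.tape enc x) T S) →
        (n : ℝ) ^ (-c) ≤
          ∑' M, (μ M).toReal *
            MatMul.prob (fun x : MatMul.Idx n → D => MatMul.RAMProduces M enc x) →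
        ε * ((n : ℝ) ^ 6 * Real.logb 2 D.card) ≤ T * S) := by
  obtain ⟨⟨ε, hε, n₀, hbp⟩, ε', hε', hram⟩ := mainTheorem6_general c
  refine ⟨⟨ε, hε, n₀, fun n hn F _ _ D μ T S hμ hp => (hbp n hn F D μ T S hμ hp).imp_left
    fun hT => le_trans ?_ hT⟩, ε', hε', fun L => (hram L).imp fun n₀ h n hn F _ _ => h n hn F⟩
  rw [mul_div_assoc]
  gcongr
  exact sqrt_div_logb_le_sqrt_div _ n
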